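/- \textbf{Conventions.} Strings are elements of $2^{<\omega}$; $\varepsilon$ is the empty string; sequences are elements of $2^\omega$. Let $p\in(0,1)$ be a real number; "oracle $p$" means the binary expansion of $p$ (the one not ending in $1^\omega$), and $p$ is computable from a sequence $X$ if this expansion is computable with oracle $X$. Here $\mu_p$ is the Bernoulli measure on $2^\omega$ under which each bit is $1$ with probability $p$, independently. A \emph{KL selection function} is a partial function $f=(s,n):2^{<\omega}\to\{\text{scan},\text{select}\}\times\mathbb N$ such that $n(\rho)\ne n(\sigma)$ whenever $\sigma$ is a proper prefix of $\rho$ and $f$ is defined on both. For a sequence $X$, put $V(0)=T(0)=\varepsilon$, and, as long as $f(V(k))$ is defined, let $V(k+1)=V(k)\,X(n(V(k)))$, and let $T(k+1)=T(k)$ if $s(V(k))=\text{scan}$ and $T(k+1)=T(k)\,X(n(V(k)))$ if $s(V(k))=\text{select}$. Write $T_f^X(k)$ for $T(k)$. We say that $f$ selects infinitely many bits of $X$ if the lengths of the strings $T_f^X(k)$ are unbounded. A \emph{$\mu_p$-KL martingale} is a pair $(f,\mathcal M)$ of a KL selection function $f$ and a function $\mathcal M:2^{<\omega}\to[0,\infty)$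 such that for every $X$ of which $f$ selects infinitely many bits, and every $k$, \[\mathcal M(T_f^X(k))=p\,\mathcal M(T_f^X(k)1)+(1-p)\,\mathcal M(T_f^X(k)0).\] A sequence $X$ is \emph{$\mu_p$-KL random} if for every $\mu_p$-KL martingale $(f,\mathcal M)$ with $f$ partial computable with oracle $p$ and $\mathcal M$ a computable real-valued function with oracle $p$, the values $\mathcal M(T_f^X(k))$ (over all $k$ for which $T_f^X(k)$ is defined) are bounded. For a \emph{stake function} $S:2^{<\omega}\to[-1,1]\cap\mathbb Q$ let $\mathcal M^p_S$ be given by $\mathcal M^p_S(\varepsilon)=1$ and \[\mathcal M^p_S(\sigma1)=\mathcal M^p_S(\sigma)\Big(1-|S(\sigma)|+\tfrac{|S(\sigma)|}{p}1_{\{S(\sigma)\ge0\}}\Big),\qquad \mathcal M^p_S(\sigma0)=\mathcal M^p_S(\sigma)\Big(1-|S(\sigma)|+\tfrac{|S(\sigma)|}{1-p}1_{\{S(\sigma)<0\}}\Big).\] A sequence $X$ is \emph{$\mu_p$-Hippocratic KL random} if for every KL selection function $f$ that is partial computable (without any oracle) and every total computable (without any oracle) stake function $S$, the values $\mathcal M^p_S(T_f^X(k))$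 (over all $k$ for which $T_f^X(k)$ is defined) are bounded. \textbf{Theorem.} For every $p\in(0,1)$ the following two statements are equivalent. \begin{enumerate} \item The $\mu_p$-Hippocratic KL random sequences and the $\mu_p$-KL random sequences are the same. \item From every $\mu_p$-Hippocratic KL random sequence $X$, $p$ is computable. \end{enumerate} -/

import Mathlib

namespace KLRand

/-! ### Oracles and relative computability -/

/-- An infinite binary sequence, as an oracle. -/
def seqOracle (X : ℕ → Bool) : ℕ →. ℕ := fun n => Part.some (if X n then 1 else 0)

/-- The sequence of bits of the binary expansion `0.x₀x₁x₂…` of a real `p ∈ (0, 1)`. -/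
noncomputable def bits (p : ℝ) : ℕ → Bool := fun n => decide (Real.digits p 2 n = 1)

/-- A function to the rationals is computable with oracles `O`: it is the quotient of an integer
(given as a difference of natural numbers) and a positive integer, both computable with
oracles `O`. -/
def ComputableRatIn {α : Type*} [Primcodable α] (O : Set (ℕ →. ℕ)) (g : α → ℚ) : Prop :=
  ∃ a b c : α → ℕ, ComputableIn O a ∧ ComputableIn O b ∧ ComputableIn O c ∧
    ∀ x, g x = ((a x : ℚ) - (b x : ℚ)) / ((c x : ℚ) + 1)

/-- A real-valued function is computable with oracles `O`: its values can be approximated by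
rationals to any precision `2⁻ⁿ`, uniformly computably with oracles `O`. -/
def ComputableRealIn {α : Type*} [Primcodable α] (O : Set (ℕ →. ℕ)) (M : α → ℝ) : Prop :=
  ∃ q : α × ℕ → ℚ, ComputableRatIn O q ∧ ∀ x n, |M x - (q (x, n) : ℝ)| ≤ (1 / 2 : ℝ) ^ n

/-! ### Selection functions -/

/-- A Kolmogorov–Loveland selection function is a partial function `f` sending the string of bits
seen so far to a pair `(s, n)`: the next bit to be read is at location `n`, and it is selected if
`s = true`, and only scanned if `s = false`. Every bit is read at most once. -/
def IsSelection (f : List Bool →. Bool × ℕ) : Prop :=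
  ∀ σ ρ : List Bool, σ <+: ρ → σ ≠ ρ → ∀ a ∈ f σ, ∀ b ∈ f ρ, b.2 ≠ a.2

/-- The pair `(V, T)` of the string of all bits seen, and the string of all bits selected, after
`f` has read `k` bits of `X`. It is undefined if `f` diverges before reading `k` bits. -/
def play (f : List Bool →. Bool × ℕ) (X : ℕ → Bool) : ℕ → Part (List Bool × List Bool)
  | 0 => Part.some ([], [])
  | k + 1 => (play f X k).bind fun vt => (f vt.1).map fun a =>
      (vt.1 ++ [X a.2], if a.1 then vt.2 ++ [X a.2] else vt.2)

/-- `f` selects infinitely many bits of `X`. -/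
def SelectsInfinitely (f : List Bool →. Bool × ℕ) (X : ℕ → Bool) : Prop :=
  ∀ m : ℕ, ∃ k, ∃ vt ∈ play f X k, m ≤ vt.2.length

/-- The capital `M` stays bounded along the strings that `f` selects from `X`. -/
def BoundedAlong (f : List Bool →. Bool × ℕ) (M : List Bool → ℝ) (X : ℕ → Bool) : Prop :=
  ∃ C : ℝ, ∀ k, ∀ vt ∈ play f X k, M vt.2 ≤ C

/-! ### Randomness with respect to the Bernoulli measure `μ_p` -/

/-- `(f, M)` is a `μ_p`-KL martingale. -/
structure IsKLMartingale (p : ℝ) (f : List Bool →. Bool × ℕ) (M : List Bool → ℝ) : Prop where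
  selection : IsSelection f
  nonneg : ∀ σ, 0 ≤ M σ
  fair : ∀ X : ℕ → Bool, SelectsInfinitely f X → ∀ k, ∀ vt ∈ play f X k,
    M vt.2 = p * M (vt.2 ++ [true]) + (1 - p) * M (vt.2 ++ [false])

/-- `X` is `μ_p`-KL random: every `μ_p`-KL martingale that is computable with oracle `p` stays
bounded on `X`. -/
def KLRandom (p : ℝ) (X : ℕ → Bool) : Prop :=
  ∀ (f : List Bool →. Bool × ℕ) (M : List Bool → ℝ), IsKLMartingale p f M →
    RecursiveIn {seqOracle (bits p)} f → ComputableRealIn {seqOracle (bits p)} M →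
    BoundedAlong f M X

/-- The factor by which the capital changes if the fraction `|s|` of it is bet, on `1` if `0 ≤ s`
and on `0` if `s < 0`, and the outcome, which is `1` with probability `p`, is `b`. -/
noncomputable def stakeFactor (p : ℝ) (s : ℚ) (b : Bool) : ℝ :=
  if b then 1 - |(s : ℝ)| + (if 0 ≤ s then |(s : ℝ)| / p else 0)
  else 1 - |(s : ℝ)| + (if s < 0 then |(s : ℝ)| / (1 - p) else 0)

/-- The `p`-martingale with initial capital `1` that arises from the stake function `S`. -/
noncomputable def stakeMartingale (p : ℝ) (S : List Bool → ℚ) (σ : List Bool) : ℝ :=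
  ∏ i : Fin σ.length, stakeFactor p (S (σ.take i)) (σ.get i)

theorem stakeMartingale_nil (p : ℝ) (S : List Bool → ℚ) : stakeMartingale p S [] = 1 := by
  simp [stakeMartingale]

theorem stakeMartingale_append (p : ℝ) (S : List Bool → ℚ) (σ : List Bool) (b : Bool) :
    stakeMartingale p S (σ ++ [b]) = stakeMartingale p S σ * stakeFactor p (S σ) b := by
  have key : ∀ τ : List Bool, stakeMartingale p S τ =
      ∏ i ∈ Finset.range τ.length, stakeFactor p (S (τ.take i)) (τ.getD i false) := by
    intro τ
    rw [Finset.prod_range]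
    simp [stakeMartingale]
  rw [key, key, List.length_append, List.length_singleton, Finset.prod_range_succ]
  congr 1
  · refine Finset.prod_congr rfl fun i hi => ?_
    have hi' := Finset.mem_range.1 hi
    rw [List.take_append_of_le_length hi'.le, List.getD_append _ _ _ _ hi']
  · simp

/-- `X` is `μ_p`-Hippocratic KL random: for all selection functions and stake functions that are
computable without an oracle, the `p`-martingale arising from the stake function stays bounded
on `X`. -/
def HippocraticKLRandom (p : ℝ) (X : ℕ → Bool) : Prop :=
  ∀ (f : List Bool →. Bool × ℕ) (S : List Bool → ℚ), IsSelection f → (∀ σ, |S σ| ≤ 1) →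
    RecursiveIn ∅ f → ComputableRatIn ∅ S → BoundedAlong f (stakeMartingale p S) X

/-- The binary expansion of `p` is computable with oracle `X`. -/
def ComputesReal (X : ℕ → Bool) (p : ℝ) : Prop :=
  ComputableIn {seqOracle X} (bits p)

end KLRand

/-! From the first statement to the second it is enough that every KL random X computes p
(`KLRandom.computesReal`). Give the bits in the k-th block, of length 15·16^k, the weight 8^(-k).
The weighted sum of the deviations X(i) - p is a fair game of total variance 20p(1-p), so its square
plus the variance still to come is a nonnegative martingale (`deviation_fair`), computable from p.
It is bounded on X, so the number of ones in block k is 15·16^k·p up to O(8^k). The block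
frequencies thus converge to p at the known rate O(2^(-k)), and the bits of p can be read off
(`computesReal_of_blockOnes`).

From the second to the first, KL random sequences are Hippocratic KL random because
`stakeMartingale` is computable from p. Conversely, let X be Hippocratic KL random. Its bits at even
locations and its bits at odd locations form Hippocratic KL random sequences too
(`HippocraticKLRandom.half`), so each half computes p. Suppose that (f, M), computable from p, is
unbounded on X. Rational stakes computable from p do as well as M up to a constant factor
(`exists_stake`), and the resulting capital is the product of the gains at even and at odd
locations. Each of these gains can be made without an oracle: read the other half of X without
betting, compute p from it, use p to follow f and the stakes, and bet only on the bits that f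
selects outside this other half. Hence both gains are bounded
(`HippocraticKLRandom.sideProd_bounded`), a contradiction.

The simulating stake function must be total, and the simulation must not stall on a computation
whose oracle is not yet known. This is why the use principle is needed in a strong form: a function
recursive in an oracle has a primitive recursive approximation on finite initial segments
(`exists_isUse_nat`). Where the approximation is undefined, the simulation stakes 0 and reads one
more bit of the oracle. -/

namespace KLRand

/-! ### The use principle -/

/-- The string of the first `k` bits of `X`. -/
def initSeg (X : ℕ → Bool) (k : ℕ) : List Bool := (List.range k).map X

@[simp] theorem initSeg_zero (X : ℕ → Bool) : initSeg X 0 = [] := rfl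

theorem initSeg_succ (X : ℕ → Bool) (k : ℕ) : initSeg X (k + 1) = initSeg X k ++ [X k] := by
  simp [initSeg, List.range_succ]

@[simp] theorem length_initSeg (X : ℕ → Bool) (k : ℕ) : (initSeg X k).length = k := by
  simp [initSeg]

theorem initSeg_getElem? (X : ℕ → Bool) (k i : ℕ) :
    (initSeg X k)[i]? = if i < k then some (X i) else none := by
  by_cases h : i < k <;> simp [initSeg, h]

theorem initSeg_prefix (X : ℕ → Bool) {k l : ℕ} (h : k ≤ l) : initSeg X k <+: initSeg X l := by
  induction l, h using Nat.le_induction with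
  | base => exact List.prefix_refl _
  | succ l _ ih => exact ih.trans (by rw [initSeg_succ]; exact List.prefix_append _ _)

/-- `F` approximates `f` from initial segments of the oracle `X`. -/
structure IsUse {α β : Type*} (X : ℕ → Bool) (f : α → Part β) (F : List Bool → α → Option β) :
    Prop where
  mono : ∀ {σ τ a y}, σ <+: τ → F σ a = some y → F τ a = some y
  mem_iff : ∀ {a y}, y ∈ f a ↔ ∃ k, F (initSeg X k) a = some y

theorem IsUse.mem {α β : Type*} {X : ℕ → Bool} {f : α → Part β} {F : List Bool → α → Option β}
    (h : IsUse X f F) {k : ℕ} {a : α} {y : β} (hy : F (initSeg X k) a = some y) : y ∈ f a :=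
  h.mem_iff.2 ⟨k, hy⟩

theorem IsUse.eventually {α β : Type*} {X : ℕ → Bool} {f : α → Part β} {F : List Bool → α → Option β}
    (h : IsUse X f F) {a : α} {y : β} (hy : y ∈ f a) :
    ∃ k, ∀ l, k ≤ l → F (initSeg X l) a = some y := by
  obtain ⟨k, hk⟩ := h.mem_iff.1 hy
  exact ⟨k, fun l hl => h.mono (initSeg_prefix X hl) hk⟩

theorem isUse_of_eventually {α β : Type*} {X : ℕ → Bool} {f : α → Part β}
    {F : List Bool → α → Option β}
    (mono : ∀ {σ τ a y}, σ <+: τ → F σ a = some y → F τ a = some y)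
    (mem : ∀ {k a y}, F (initSeg X k) a = some y → y ∈ f a)
    (ev : ∀ {a y}, y ∈ f a → ∃ k, F (initSeg X k) a = some y) : IsUse X f F :=
  ⟨mono, ⟨ev, fun ⟨_, h⟩ => mem h⟩⟩

theorem isUse_seqOracle (X : ℕ → Bool) :
    IsUse X (seqOracle X) fun σ n => (σ[n]?).map fun b => if b then 1 else 0 := by
  refine isUse_of_eventually ?_ ?_ ?_
  · intro σ τ n y hστ h
    obtain ⟨b, hb, rfl⟩ := Option.map_eq_some_iff.1 h
    obtain ⟨ρ, rfl⟩ := hστ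
    have : (σ ++ ρ)[n]? = some b := by
      rw [List.getElem?_append_left (List.getElem?_eq_some_iff.1 hb).1, hb]
    rw [this]
    rfl
  · intro k n y h
    rw [initSeg_getElem?] at h
    split_ifs at h
    · exact Part.mem_some_iff.2 (Option.some.inj h).symm
    · simp at h
  · intro n y h
    refine ⟨n + 1, ?_⟩
    rw [initSeg_getElem?, if_pos (Nat.lt_succ_self n)]
    exact congrArg some (Part.mem_some_iff.1 h).symm

theorem mem_pair_iff {u v : Part ℕ} {y : ℕ} :
    y ∈ (Nat.pair <$> u <*> v) ↔ ∃ a ∈ u, ∃ b ∈ v, Nat.pair a b = y := by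
  simp only [Seq.seq, Part.map_eq_map, Part.bind_map, Part.mem_bind_iff, Part.mem_map_iff]

theorem IsUse.pair {X : ℕ → Bool} {f g : ℕ → Part ℕ} {F G : List Bool → ℕ → Option ℕ}
    (hf : IsUse X f F) (hg : IsUse X g G) :
    IsUse X (fun n => Nat.pair <$> f n <*> g n)
      fun σ n => (F σ n).bind fun a => (G σ n).map fun b => Nat.pair a b := by
  refine isUse_of_eventually ?_ ?_ ?_
  · intro σ τ n y hστ h
    simp only [Option.bind_eq_some_iff, Option.map_eq_some_iff] at h ⊢
    obtain ⟨a, ha, b, hb, rfl⟩ := h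
    exact ⟨a, hf.mono hστ ha, b, hg.mono hστ hb, rfl⟩
  · intro k n y h
    simp only [Option.bind_eq_some_iff, Option.map_eq_some_iff] at h
    obtain ⟨a, ha, b, hb, rfl⟩ := h
    exact mem_pair_iff.2 ⟨a, hf.mem ha, b, hg.mem hb, rfl⟩
  · intro n y h
    obtain ⟨a, ha, b, hb, rfl⟩ := mem_pair_iff.1 h
    obtain ⟨k, hk⟩ := hf.eventually ha
    obtain ⟨l, hl⟩ := hg.eventually hb
    refine ⟨max k l, ?_⟩
    simp [hk _ (le_max_left k l), hl _ (le_max_right k l)]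

theorem IsUse.comp {α β γ : Type*} {X : ℕ → Bool} {f : β → Part γ} {g : α → Part β}
    {F : List Bool → β → Option γ} {G : List Bool → α → Option β}
    (hf : IsUse X f F) (hg : IsUse X g G) :
    IsUse X (fun n => (g n).bind f) fun σ n => (G σ n).bind (F σ) := by
  refine isUse_of_eventually ?_ ?_ ?_
  · intro σ τ n y hστ h
    simp only [Option.bind_eq_some_iff] at h ⊢
    obtain ⟨a, ha, hy⟩ := h
    exact ⟨a, hg.mono hστ ha, hf.mono hστ hy⟩
  · intro k n y h
    simp only [Option.bind_eq_some_iff] at h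
    obtain ⟨a, ha, hy⟩ := h
    exact Part.mem_bind_iff.2 ⟨a, hg.mem ha, hf.mem hy⟩
  · intro n y h
    obtain ⟨a, ha, hy⟩ := Part.mem_bind_iff.1 h
    obtain ⟨k, hk⟩ := hg.eventually ha
    obtain ⟨l, hl⟩ := hf.eventually hy
    refine ⟨max k l, ?_⟩
    simp [hk _ (le_max_left k l), hl _ (le_max_right k l)]

theorem IsUse.prec {X : ℕ → Bool} {f g : ℕ → Part ℕ} {F G : List Bool → ℕ → Option ℕ}
    (hf : IsUse X f F) (hg : IsUse X g G) :
    IsUse X (fun p : ℕ => p.unpair.2.rec (f p.unpair.1) fun y IH =>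
        IH.bind fun i => g (Nat.pair p.unpair.1 (Nat.pair y i)))
      fun σ (p : ℕ) => p.unpair.2.rec (F σ p.unpair.1) fun y IH =>
        IH.bind fun i => G σ (Nat.pair p.unpair.1 (Nat.pair y i)) := by
  refine isUse_of_eventually ?_ ?_ ?_
  · intro σ τ p y hστ
    induction p.unpair.2 generalizing y with
    | zero => exact hf.mono hστ
    | succ n ih =>
      intro h
      simp only [Option.bind_eq_some_iff] at h ⊢
      obtain ⟨a, ha, hy⟩ := h
      exact ⟨a, ih ha, hg.mono hστ hy⟩
  · intro k p y
    induction p.unpair.2 generalizing y with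
    | zero => exact hf.mem
    | succ n ih =>
      intro h
      simp only [Option.bind_eq_some_iff] at h
      obtain ⟨a, ha, hy⟩ := h
      exact Part.mem_bind_iff.2 ⟨a, ih ha, hg.mem hy⟩
  · intro p y h
    -- Convergence is claimed for all longer segments, so that the segment needed for the earlier
    -- values and that for the next call of `g` can be merged by a maximum.
    suffices ∃ k, ∀ l, k ≤ l → (p.unpair.2.rec (F (initSeg X l) p.unpair.1) fun y IH =>
        IH.bind fun i => G (initSeg X l) (Nat.pair p.unpair.1 (Nat.pair y i)) : Option ℕ)
          = some y from
      let ⟨k, hk⟩ := this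
      ⟨k, hk k le_rfl⟩
    revert h
    induction p.unpair.2 generalizing y with
    | zero => exact hf.eventually
    | succ n ih =>
      intro h
      obtain ⟨a, ha, hy⟩ := Part.mem_bind_iff.1 h
      obtain ⟨k, hk⟩ := ih ha
      obtain ⟨l, hl⟩ := hg.eventually hy
      refine ⟨max k l, fun m hm => ?_⟩
      simp only [Option.bind_eq_some_iff]
      exact ⟨a, hk _ ((le_max_left k l).trans hm), hl _ ((le_max_right k l).trans hm)⟩

/-- The approximation of an unbounded search that looks only at candidates up to the length of the
known part of the oracle. -/
def searchUse (F : List Bool → ℕ → Option ℕ) (σ : List Bool) (a : ℕ) : Option ℕ :=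
  let m := (List.range σ.length).findIdx fun n => decide ((F σ (Nat.pair a n)).getD 0 = 0)
  if F σ (Nat.pair a m) = some 0 then some m else none

/-- The default 0 makes the search halt at an undefined value instead of passing over it, and the
final test then rejects that candidate. When nothing is found, `findIdx` returns the length, which
is tested as well; hence `m ≤ σ.length` and not a strict bound. -/
theorem searchUse_eq_some {F : List Bool → ℕ → Option ℕ} {σ : List Bool} {a m : ℕ} :
    searchUse F σ a = some m ↔ m ≤ σ.length ∧ F σ (Nat.pair a m) = some 0 ∧
      ∀ j < m, ∃ y, F σ (Nat.pair a j) = some (y + 1) := by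
  have key : ∀ z : Option ℕ, ¬ z.getD 0 = 0 ↔ ∃ y, z = some (y + 1) := by
    rintro (_ | _ | z) <;> simp
  simp only [searchUse, Option.ite_none_right_eq_some]
  constructor
  · rintro ⟨h0, h⟩
    obtain rfl := Option.some.inj h
    refine ⟨List.findIdx_le_length.trans (by simp), h0, fun j hj => ?_⟩
    have := List.not_of_lt_findIdx hj
    rw [← key]
    simpa using this
  · rintro ⟨hm, h0, hj⟩
    suffices h : (List.range σ.length).findIdx
        (fun n => decide ((F σ (Nat.pair a n)).getD 0 = 0)) = m by
      rw [h]; exact ⟨h0, rfl⟩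
    rcases hm.lt_or_eq with hm | rfl
    · rw [List.findIdx_eq (by simpa using hm)]
      refine ⟨by simp [h0], fun j hjm => ?_⟩
      simpa using (key _).2 (hj j hjm)
    · rw [List.findIdx_eq_length_of_false]
      · simp
      · intro j hjm
        simpa using (key _).2 (hj j (by simpa using hjm))

/-- A successful search evaluates only finitely many values, so one segment suffices for all of
them; making it also at least as long as the answer brings the answer within the search bound. -/
theorem IsUse.rfind {X : ℕ → Bool} {f : ℕ → Part ℕ} {F : List Bool → ℕ → Option ℕ}
    (hf : IsUse X f F) :
    IsUse X (fun a => Nat.rfind fun n => (fun m => decide (m = 0)) <$> f (Nat.pair a n))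
      (searchUse F) := by
  refine isUse_of_eventually ?_ ?_ ?_
  · intro σ τ a m hστ h
    rw [searchUse_eq_some] at h ⊢
    obtain ⟨hm, h0, hj⟩ := h
    refine ⟨hm.trans hστ.length_le, hf.mono hστ h0, fun j hjm => ?_⟩
    obtain ⟨y, hy⟩ := hj j hjm
    exact ⟨y, hf.mono hστ hy⟩
  · intro k a m h
    rw [searchUse_eq_some] at h
    obtain ⟨-, h0, hj⟩ := h
    refine Nat.mem_rfind.2 ⟨by simpa using hf.mem h0, fun {j} hjm => ?_⟩
    obtain ⟨y, hy⟩ := hj j hjm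
    simpa using ⟨_, hf.mem hy, by simp⟩
  · intro a m h
    obtain ⟨h0, hj⟩ := Nat.mem_rfind.1 h
    have h0 : 0 ∈ f (Nat.pair a m) := by simpa using h0
    have hj : ∀ j < m, ∃ k, ∀ l, k ≤ l → ∃ y, F (initSeg X l) (Nat.pair a j) = some (y + 1) := by
      intro j hjm
      obtain ⟨y, hy, hy0⟩ : ∃ y ∈ f (Nat.pair a j), y ≠ 0 := by simpa using hj hjm
      obtain ⟨y, rfl⟩ := Nat.exists_eq_succ_of_ne_zero hy0
      obtain ⟨k, hk⟩ := hf.eventually hy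
      exact ⟨k, fun l hl => ⟨y, hk l hl⟩⟩
    choose! K hK using hj
    obtain ⟨k, hk⟩ := hf.eventually h0
    refine ⟨max (max k m) ((Finset.range m).sup K), ?_⟩
    rw [searchUse_eq_some]
    refine ⟨by simp, hk _ (by simp), fun j hjm => hK j hjm _ ?_⟩
    exact (Finset.le_sup (f := K) (Finset.mem_range.2 hjm)).trans (le_max_right _ _)

theorem primrec_searchUse {F : List Bool → ℕ → Option ℕ} (hF : Primrec₂ F) :
    Primrec₂ (searchUse F) := by
  have hm : Primrec fun x : List Bool × ℕ => (List.range x.1.length).findIdx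
      fun n => decide ((F x.1 (Nat.pair x.2 n)).getD 0 = 0) := by
    refine Primrec.list_findIdx
      (Primrec.list_range.comp (Primrec.list_length.comp Primrec.fst)) ?_
    refine (PrimrecRel.comp Primrec.eq (Primrec.option_getD.comp (hF.comp
      (Primrec.fst.comp Primrec.fst) (Primrec₂.natPair.comp
        (Primrec.snd.comp Primrec.fst) Primrec.snd)) (Primrec.const 0)) (Primrec.const 0)).decide
  exact Primrec.ite (PrimrecRel.comp Primrec.eq (hF.comp Primrec.fst
    (Primrec₂.natPair.comp Primrec.snd hm)) (Primrec.const (some 0)))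
    (Primrec.option_some.comp hm) (Primrec.const none)

/-- Every operation that generates the recursive functions preserves the existence of a use. Only
unbounded search could leave the primitive recursive functions, and there the length of the known
segment serves as a bound. -/
theorem exists_isUse_nat {X : ℕ → Bool} {f : ℕ →. ℕ} (h : Nat.RecursiveIn {seqOracle X} f) :
    ∃ F : List Bool → ℕ → Option ℕ, Primrec₂ F ∧ IsUse X f F := by
  have tot : ∀ {g : ℕ → ℕ}, Nat.Primrec g →
      ∃ F : List Bool → ℕ → Option ℕ, Primrec₂ F ∧ IsUse X (fun n => Part.some (g n)) F := by
    intro g hg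
    refine ⟨fun _ n => some (g n), Primrec.option_some.comp ((Primrec.nat_iff.2 hg).comp
      Primrec.snd), isUse_of_eventually (fun _ h => h) ?_ ?_⟩ <;> simp [eq_comm]
  induction h with
  | zero => exact tot Nat.Primrec.zero
  | succ => exact tot Nat.Primrec.succ
  | left => exact tot Nat.Primrec.left
  | right => exact tot Nat.Primrec.right
  | oracle g hg =>
    obtain rfl := Set.mem_singleton_iff.1 hg
    exact ⟨_, (Primrec.option_map (Primrec.list_getElem?.comp Primrec.fst Primrec.snd)
      ((Primrec.dom_bool fun b : Bool => if b then 1 else 0).comp Primrec.snd).to₂).to₂, isUse_seqOracle X⟩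
  | pair _ _ ihf ihg =>
    obtain ⟨F, hF, hf⟩ := ihf
    obtain ⟨G, hG, hg⟩ := ihg
    have : Primrec fun x : (List Bool × ℕ) × ℕ => (G x.1.1 x.1.2).map fun b => Nat.pair x.2 b :=
      Primrec.option_map (hG.comp (Primrec.fst.comp Primrec.fst) (Primrec.snd.comp Primrec.fst))
        (Primrec₂.natPair.comp (Primrec.snd.comp Primrec.fst) Primrec.snd).to₂
    exact ⟨_, (Primrec.option_bind hF this.to₂).to₂, hf.pair hg⟩
  | comp _ _ ihf ihg =>
    obtain ⟨F, hF, hf⟩ := ihf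
    obtain ⟨G, hG, hg⟩ := ihg
    exact ⟨_, (Primrec.option_bind hG
      (hF.comp (Primrec.fst.comp Primrec.fst) Primrec.snd).to₂).to₂, hf.comp hg⟩
  | prec _ _ ihf ihg =>
    obtain ⟨F, hF, hf⟩ := ihf
    obtain ⟨G, hG, hg⟩ := ihg
    have h1 : Primrec fun x : List Bool × ℕ => x.2.unpair.1 :=
      Primrec.fst.comp (Primrec.unpair.comp Primrec.snd)
    have h2 : Primrec fun x : List Bool × ℕ => x.2.unpair.2 :=
      Primrec.snd.comp (Primrec.unpair.comp Primrec.snd)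
    refine ⟨fun σ p => p.unpair.2.rec (F σ p.unpair.1) fun y IH =>
        IH.bind fun i => G σ (Nat.pair p.unpair.1 (Nat.pair y i)), Primrec₂.mk ?_, hf.prec hg⟩
    refine Primrec.nat_rec' (h := fun (x : List Bool × ℕ) (q : ℕ × Option ℕ) => q.2.bind fun i =>
      G x.1 (Nat.pair x.2.unpair.1 (Nat.pair q.1 i))) h2 (hF.comp Primrec.fst h1)
      (Primrec₂.mk ?_)
    refine Primrec.option_bind (Primrec.snd.comp Primrec.snd) (Primrec₂.mk ?_)
    exact hG.comp (Primrec.fst.comp (Primrec.fst.comp Primrec.fst)) (Primrec₂.natPair.comp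
      (h1.comp (Primrec.fst.comp Primrec.fst)) (Primrec₂.natPair.comp
        (Primrec.fst.comp (Primrec.snd.comp Primrec.fst)) Primrec.snd))
  | rfind _ ihf =>
    obtain ⟨F, hF, hf⟩ := ihf
    exact ⟨_, primrec_searchUse hF, hf.rfind⟩

section

variable {α β γ : Type*} [Primcodable α] [Primcodable β] [Primcodable γ]

/-- A function that is recursive in a sequence is approximated, primitive recursively, from the
initial segments of this sequence. -/
theorem exists_isUse {X : ℕ → Bool} {f : α →. β} (h : RecursiveIn {seqOracle X} f) :
    ∃ F : List Bool → α → Option β, Primrec₂ F ∧ IsUse X f F := by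
  obtain ⟨F, hF, hf⟩ := exists_isUse_nat h
  refine ⟨fun σ a => (F σ (Encodable.encode a)).bind Encodable.decode, ?_, ?_⟩
  · exact Primrec.option_bind (hF.comp Primrec.fst (Primrec.encode.comp Primrec.snd))
      (Primrec.decode.comp Primrec.snd)
  · refine isUse_of_eventually ?_ ?_ ?_
    · intro σ τ a y hστ h
      simp only [Option.bind_eq_some_iff] at h ⊢
      obtain ⟨n, hn, hy⟩ := h
      exact ⟨n, hf.mono hστ hn, hy⟩
    · intro k a y h
      simp only [Option.bind_eq_some_iff] at h
      obtain ⟨n, hn, hy⟩ := h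
      obtain ⟨z, hz, rfl⟩ : ∃ z ∈ f a, Encodable.encode z = n := by simpa using hf.mem hn
      obtain rfl : z = y := by simpa using hy
      exact hz
    · intro a y h
      obtain ⟨k, hk⟩ := hf.mem_iff.1 (show Encodable.encode y ∈ (Part.bind
        (Encodable.decode (α := α) (Encodable.encode a)) fun a => (f a).map Encodable.encode) by
          simpa using h)
      exact ⟨k, by simp [hk]⟩

/-! ### Converse of the use principle: from approximations on initial segments back to the oracle -/

theorem ComputableIn.comp {O : Set (ℕ →. ℕ)} {f : β → γ} {g : α → β} (hf : ComputableIn O f)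
    (hg : ComputableIn O g) : ComputableIn O fun a => f (g a) :=
  (Nat.RecursiveIn.comp hf hg).of_eq fun n => by
    cases (Encodable.decode n : Option α) <;> simp

theorem ComputableIn.pair {O : Set (ℕ →. ℕ)} {f : α → β} {g : α → γ} (hf : ComputableIn O f)
    (hg : ComputableIn O g) : ComputableIn O fun a => (f a, g a) :=
  (Nat.RecursiveIn.pair hf hg).of_eq fun n => by
    cases (Encodable.decode n : Option α) <;> simp [Seq.seq]

theorem computableIn_oracle (X : ℕ → Bool) : ComputableIn {seqOracle X} X := by
  have h1 : ComputableIn {seqOracle X} fun n => if X n then 1 else 0 :=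
    RecursiveIn.oracle (seqOracle X) rfl
  have h2 : ComputableIn {seqOracle X} fun n : ℕ => decide (n = 1) :=
    Primrec.computableIn (PrimrecRel.comp Primrec.eq Primrec.id (Primrec.const 1)).decide
  have := ComputableIn.comp h2 h1
  simpa using this

theorem ComputableIn.nat_rec {O : Set (ℕ →. ℕ)} {g : ℕ × β → β} (s : β)
    (hg : ComputableIn O g) :
    ComputableIn O fun n : ℕ => (Nat.rec s (fun n b => g (n, b)) n : β) := by
  have h0 : Nat.RecursiveIn O fun _ => Part.some (Encodable.encode s) :=
    Nat.Primrec.recursiveIn (Nat.Primrec.const _)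
  have h1 : Nat.RecursiveIn O fun n => Part.some n.unpair.2 :=
    Nat.Primrec.recursiveIn Nat.Primrec.right
  -- Primitive recursion on coded pairs carries a parameter; it is set to 0 and dropped by the
  -- projection in `h1`.
  have key := Nat.RecursiveIn.comp (Nat.RecursiveIn.prec h0 (Nat.RecursiveIn.comp hg h1))
    (Nat.Primrec.recursiveIn (Nat.Primrec.pair Nat.Primrec.zero Nat.Primrec.id))
  refine key.of_eq fun n => ?_
  simp only [Nat.unpair_pair, id, Part.bind_eq_bind, Part.coe_some, Part.bind_some,
    Encodable.decode_nat, Part.map_some]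
  induction n with
  | zero => rfl
  | succ n ih =>
    simp only [ih, Part.bind_some]
    simp

theorem computableIn_initSeg (X : ℕ → Bool) : ComputableIn {seqOracle X} (initSeg X) := by
  have h : ComputableIn {seqOracle X} fun x : ℕ × List Bool => x.2 ++ [X x.1] :=
    ComputableIn.comp (f := fun x : List Bool × Bool => x.1 ++ [x.2])
      Primrec.list_concat.computableIn (ComputableIn.pair ComputableIn.snd
        (ComputableIn.comp (computableIn_oracle X) ComputableIn.fst))
  convert ComputableIn.nat_rec [] h using 2 with n
  induction n with
  | zero => rfl
  | succ n ih => rw [initSeg_succ, ih]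

/-- A function that is approximated, computably, from the initial segments of a sequence, is
recursive in this sequence. -/
theorem recursiveIn_of_computable {X : ℕ → Bool} {f : α →. β} {F : List Bool → α → Option β}
    (hF : Computable₂ F) (hf : ∀ a y, y ∈ f a ↔ ∃ k, F (initSeg X k) a = some y) :
    RecursiveIn {seqOracle X} f := by
  -- An input and a stage are paired in `n`. The code of an option is 0 for `none` and otherwise one
  -- more than the code of the value: so `1 - code` vanishes exactly at the stages with an output,
  -- where the search stops, and the predecessor recovers the code of the value.
  have hE : ComputableIn {seqOracle X} fun n : ℕ => Encodable.encode
      ((Encodable.decode n.unpair.1 : Option α).bind (F (initSeg X n.unpair.2))) := by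
    have h1 : Computable fun x : List Bool × ℕ => Encodable.encode
        ((Encodable.decode x.2.unpair.1 : Option α).bind (F x.1)) :=
      Computable.encode.comp (Computable.option_bind (Computable.decode.comp
        (Computable.fst.comp (Computable.unpair.comp Computable.snd)))
        (hF.comp (Computable.fst.comp Computable.fst) Computable.snd))
    exact ComputableIn.comp (g := fun n : ℕ => (initSeg X n.unpair.2, n)) h1.computableIn (ComputableIn.pair (ComputableIn.comp
      (computableIn_initSeg X) (Primrec.snd.comp Primrec.unpair).computableIn) ComputableIn.id)
  have hS : Nat.RecursiveIn {seqOracle X} _ := RecursiveIn.iff_nat.1 (ComputableIn.comp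
    (Primrec.computableIn (Primrec.nat_sub.comp (Primrec.const 1) Primrec.id)) hE)
  have hP : Nat.RecursiveIn {seqOracle X} _ := RecursiveIn.iff_nat.1 (ComputableIn.comp
    Primrec.pred.computableIn hE)
  have key := hP.comp (Nat.RecursiveIn.pair (Nat.Primrec.recursiveIn Nat.Primrec.id) hS.rfind)
  refine key.of_eq fun n => Part.ext fun y => ?_
  have hmem : ∀ y, (y ∈ (Part.bind (Encodable.decode n : Option α) fun a =>
      (f a).map Encodable.encode)) ↔ ∃ k, ∃ z, ((Encodable.decode n : Option α).bind
        (F (initSeg X k))) = some z ∧ Encodable.encode z = y := by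
    intro y
    cases (Encodable.decode n : Option α) with
    | none => simp
    | some a =>
      simp only [Part.coe_some, Part.bind_some, Part.mem_map_iff, hf, Option.bind_some]
      exact ⟨fun ⟨z, ⟨k, hk⟩, h⟩ => ⟨k, z, hk, h⟩, fun ⟨k, z, hk, h⟩ => ⟨z, ⟨k, hk⟩, h⟩⟩
  rw [hmem]
  set o : ℕ → Option β := fun k => (Encodable.decode n : Option α).bind (F (initSeg X k)) with ho
  have hR : ∀ k, (k ∈ Nat.rfind fun k => (fun m => decide (m = 0)) <$> (Part.some (1 -
      Encodable.encode ((Encodable.decode (Nat.pair n k).unpair.1 : Option α).bind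
        (F (initSeg X (Nat.pair n k).unpair.2)))) : Part ℕ)) ↔
      o k ≠ none ∧ ∀ j < k, o j = none := by
    have h0 : ∀ k, 1 - Encodable.encode (o k) = 0 ↔ o k ≠ none := by
      intro k
      cases o k <;> simp
    have h1 : ∀ k, 1 - Encodable.encode (o k) ≠ 0 ↔ o k = none := fun k => by
      rw [ne_eq, h0, not_not]
    intro k
    rw [← h0]
    simp only [← h1]
    simp only [Nat.unpair_pair]
    refine Nat.mem_rfind.trans (and_congr ?_ (forall_congr' fun j => forall_congr' fun _ => ?_))
    · simp [ho]
    · simp [ho]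
  constructor
  · intro h
    obtain ⟨z, hz, hy⟩ := Part.mem_bind_iff.1 h
    obtain ⟨a, ha, k, hk, rfl⟩ := mem_pair_iff.1 hz
    obtain rfl := Part.mem_some_iff.1 ha
    obtain ⟨z, hz⟩ := Option.ne_none_iff_exists'.1 ((hR k).1 hk).1
    refine ⟨k, z, hz, ?_⟩
    simp only [ho] at hz
    simpa [hz] using (Part.mem_some_iff.1 hy).symm
  · rintro ⟨k, z, hz, rfl⟩
    have hex : ∃ k, o k ≠ none := ⟨k, by simp [ho, hz]⟩
    classical
    let l := Nat.find hex
    have hl : o l ≠ none ∧ ∀ j < l, o j = none :=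
      ⟨Nat.find_spec hex, fun j hj => not_not.1 (Nat.find_min hex hj)⟩
    obtain ⟨w, hw⟩ := Option.ne_none_iff_exists'.1 hl.1
    -- The search stops at the first stage `l`, not at the given stage `k`; both outputs agree
    -- because `f` is single-valued.
    have hwz : Encodable.encode z = Encodable.encode w :=
      Part.mem_unique ((hmem _).2 ⟨k, z, hz, rfl⟩) ((hmem _).2 ⟨l, w, hw, rfl⟩)
    refine Part.mem_bind_iff.2 ⟨_, mem_pair_iff.2 ⟨n, Part.mem_some _, l, (hR l).2 hl, rfl⟩, ?_⟩
    simp only [ho] at hw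
    refine Part.mem_some_iff.2 ?_
    simp [hw, hwz]

theorem computableIn_of_computable {X : ℕ → Bool} {f : α → β} {F : List Bool → α → Option β}
    (hF : Computable₂ F) (sound : ∀ a k y, F (initSeg X k) a = some y → y = f a)
    (complete : ∀ a, ∃ k, F (initSeg X k) a = some (f a)) : ComputableIn {seqOracle X} f :=
  recursiveIn_of_computable hF fun a y => by
    rw [Part.mem_some_iff]
    exact ⟨fun h => h ▸ complete a, fun ⟨k, hk⟩ => sound a k y hk⟩

theorem computableIn_of_prefix {X : ℕ → Bool} {G : List Bool × α → β} {l : α → ℕ}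
    (hG : Computable G) (hl : Computable l) :
    ComputableIn {seqOracle X} fun a => G (initSeg X (l a), a) :=
  ComputableIn.comp hG.computableIn (ComputableIn.pair (ComputableIn.comp
    (computableIn_initSeg X) hl.computableIn) (ComputableIn.id))

end

/-! ### Computable functions to the rationals -/

/-- The rational number `(a - b) / (c + 1)` that is represented by the triple `(a, b, c)`. -/
def ratVal (r : ℕ × ℕ × ℕ) : ℚ := ((r.1 : ℚ) - (r.2.1 : ℚ)) / ((r.2.2 : ℚ) + 1)

/-- The last entry of a triple is the denominator minus one, and (c + 1)(d + 1) - 1 = cd + c + d. -/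
def addTriple (r s : ℕ × ℕ × ℕ) : ℕ × ℕ × ℕ :=
  (r.1 * (s.2.2 + 1) + s.1 * (r.2.2 + 1), r.2.1 * (s.2.2 + 1) + s.2.1 * (r.2.2 + 1),
    r.2.2 * s.2.2 + r.2.2 + s.2.2)

def mulTriple (r s : ℕ × ℕ × ℕ) : ℕ × ℕ × ℕ :=
  (r.1 * s.1 + r.2.1 * s.2.1, r.1 * s.2.1 + r.2.1 * s.1, r.2.2 * s.2.2 + r.2.2 + s.2.2)

/-- The sign of the numerator decides where the old denominator goes, since the new denominator must
be positive. Zero is sent to zero, in accordance with `0⁻¹ = 0`. -/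
def invTriple (r : ℕ × ℕ × ℕ) : ℕ × ℕ × ℕ :=
  if r.2.1 = r.1 then (0, 0, 0)
  else if r.2.1 ≤ r.1 then (r.2.2 + 1, 0, r.1 - r.2.1 - 1) else (0, r.2.2 + 1, r.2.1 - r.1 - 1)

theorem ratVal_add (r s : ℕ × ℕ × ℕ) : ratVal (addTriple r s) = ratVal r + ratVal s := by
  simp only [ratVal, addTriple]
  have h1 : (r.2.2 : ℚ) + 1 ≠ 0 := by positivity
  have h2 : (s.2.2 : ℚ) + 1 ≠ 0 := by positivity
  rw [div_add_div _ _ h1 h2]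
  push_cast
  congr 1 <;> ring

theorem ratVal_mul (r s : ℕ × ℕ × ℕ) : ratVal (mulTriple r s) = ratVal r * ratVal s := by
  simp only [ratVal, mulTriple]
  rw [div_mul_div_comm]
  push_cast
  congr 1 <;> ring

theorem ratVal_inv (r : ℕ × ℕ × ℕ) : ratVal (invTriple r) = (ratVal r)⁻¹ := by
  obtain ⟨a, b, c⟩ := r
  simp only [ratVal, invTriple]
  rw [inv_div]
  split_ifs with h1 h2
  · simp [h1]
  · obtain ⟨d, rfl⟩ := Nat.exists_eq_add_of_lt (lt_of_le_of_ne h2 h1)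
    have : b + d + 1 - b - 1 = d := by omega
    simp only [this]
    push_cast
    congr 1 <;> ring
  · obtain ⟨d, rfl⟩ := Nat.exists_eq_add_of_lt (not_le.1 h2)
    have : a + d + 1 - a - 1 = d := by omega
    simp only [this]
    push_cast
    rw [show (a : ℚ) - (a + d + 1) = -(d + 1) by ring, div_neg, zero_sub, neg_div]

/-! ### Primitive recursiveness of the arithmetic of triples -/

section Primrec

theorem primrec_nat_pow : Primrec₂ fun m n : ℕ => m ^ n :=
  Primrec₂.unpaired'.1 Nat.Primrec.pow

theorem primrec_nat_add_one : Primrec fun n : ℕ => n + 1 := Primrec.succ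

theorem primrec_addTriple : Primrec₂ addTriple := by
  have a1 : Primrec fun x : (ℕ × ℕ × ℕ) × (ℕ × ℕ × ℕ) => x.1.1 := Primrec.fst.comp Primrec.fst
  have a2 : Primrec fun x : (ℕ × ℕ × ℕ) × (ℕ × ℕ × ℕ) => x.1.2.1 :=
    Primrec.fst.comp (Primrec.snd.comp Primrec.fst)
  have a3 : Primrec fun x : (ℕ × ℕ × ℕ) × (ℕ × ℕ × ℕ) => x.1.2.2 :=
    Primrec.snd.comp (Primrec.snd.comp Primrec.fst)
  have b1 : Primrec fun x : (ℕ × ℕ × ℕ) × (ℕ × ℕ × ℕ) => x.2.1 := Primrec.fst.comp Primrec.snd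
  have b2 : Primrec fun x : (ℕ × ℕ × ℕ) × (ℕ × ℕ × ℕ) => x.2.2.1 :=
    Primrec.fst.comp (Primrec.snd.comp Primrec.snd)
  have b3 : Primrec fun x : (ℕ × ℕ × ℕ) × (ℕ × ℕ × ℕ) => x.2.2.2 :=
    Primrec.snd.comp (Primrec.snd.comp Primrec.snd)
  have a3' := primrec_nat_add_one.comp a3
  have b3' := primrec_nat_add_one.comp b3
  exact Primrec₂.mk (Primrec.pair
    (Primrec.nat_add.comp (Primrec.nat_mul.comp a1 b3') (Primrec.nat_mul.comp b1 a3'))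
    (Primrec.pair
      (Primrec.nat_add.comp (Primrec.nat_mul.comp a2 b3') (Primrec.nat_mul.comp b2 a3'))
      (Primrec.nat_add.comp (Primrec.nat_add.comp (Primrec.nat_mul.comp a3 b3) a3) b3)))

theorem primrec_mulTriple : Primrec₂ mulTriple := by
  have a1 : Primrec fun x : (ℕ × ℕ × ℕ) × (ℕ × ℕ × ℕ) => x.1.1 := Primrec.fst.comp Primrec.fst
  have a2 : Primrec fun x : (ℕ × ℕ × ℕ) × (ℕ × ℕ × ℕ) => x.1.2.1 :=
    Primrec.fst.comp (Primrec.snd.comp Primrec.fst)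
  have a3 : Primrec fun x : (ℕ × ℕ × ℕ) × (ℕ × ℕ × ℕ) => x.1.2.2 :=
    Primrec.snd.comp (Primrec.snd.comp Primrec.fst)
  have b1 : Primrec fun x : (ℕ × ℕ × ℕ) × (ℕ × ℕ × ℕ) => x.2.1 := Primrec.fst.comp Primrec.snd
  have b2 : Primrec fun x : (ℕ × ℕ × ℕ) × (ℕ × ℕ × ℕ) => x.2.2.1 :=
    Primrec.fst.comp (Primrec.snd.comp Primrec.snd)
  have b3 : Primrec fun x : (ℕ × ℕ × ℕ) × (ℕ × ℕ × ℕ) => x.2.2.2 :=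
    Primrec.snd.comp (Primrec.snd.comp Primrec.snd)
  exact Primrec₂.mk (Primrec.pair
    (Primrec.nat_add.comp (Primrec.nat_mul.comp a1 b1) (Primrec.nat_mul.comp a2 b2))
    (Primrec.pair
      (Primrec.nat_add.comp (Primrec.nat_mul.comp a1 b2) (Primrec.nat_mul.comp a2 b1))
      (Primrec.nat_add.comp (Primrec.nat_add.comp (Primrec.nat_mul.comp a3 b3) a3) b3)))

theorem primrec_nat_sub_one : Primrec fun n : ℕ => n - 1 := Primrec.pred

theorem primrec_invTriple : Primrec invTriple := by
  have a1 : Primrec fun x : ℕ × ℕ × ℕ => x.1 := Primrec.fst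
  have a2 : Primrec fun x : ℕ × ℕ × ℕ => x.2.1 := Primrec.fst.comp Primrec.snd
  have a3 : Primrec fun x : ℕ × ℕ × ℕ => x.2.2 := Primrec.snd.comp Primrec.snd
  have a3' := primrec_nat_add_one.comp a3
  exact Primrec.ite (PrimrecRel.comp Primrec.eq a2 a1) (Primrec.const _)
    (Primrec.ite (PrimrecRel.comp Primrec.nat_le a2 a1)
      (Primrec.pair a3' (Primrec.pair (Primrec.const 0)
        (primrec_nat_sub_one.comp (Primrec.nat_sub.comp a1 a2))))
      (Primrec.pair (Primrec.const 0) (Primrec.pair a3'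
        (primrec_nat_sub_one.comp (Primrec.nat_sub.comp a2 a1)))))

end Primrec

/-- A function to the rationals that is computable without an oracle. -/
def RatComputable {α : Type*} [Primcodable α] (g : α → ℚ) : Prop :=
  ∃ r : α → ℕ × ℕ × ℕ, Computable r ∧ ∀ x, g x = ratVal (r x)

section

variable {α β : Type*} [Primcodable α] [Primcodable β]

theorem computableRatIn_iff {O : Set (ℕ →. ℕ)} {g : α → ℚ} :
    ComputableRatIn O g ↔ ∃ r : α → ℕ × ℕ × ℕ, ComputableIn O r ∧ ∀ x, g x = ratVal (r x) := by
  constructor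
  · rintro ⟨a, b, c, ha, hb, hc, h⟩
    exact ⟨fun x => (a x, b x, c x), ComputableIn.pair ha (ComputableIn.pair hb hc), h⟩
  · rintro ⟨r, hr, h⟩
    exact ⟨fun x => (r x).1, fun x => (r x).2.1, fun x => (r x).2.2,
      ComputableIn.comp Primrec.fst.computableIn hr,
      ComputableIn.comp (f := fun r : ℕ × ℕ × ℕ => r.2.1)
        (Primrec.fst.comp Primrec.snd).computableIn hr,
      ComputableIn.comp (f := fun r : ℕ × ℕ × ℕ => r.2.2)
        (Primrec.snd.comp Primrec.snd).computableIn hr, h⟩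

theorem computableRatIn_empty_iff {g : α → ℚ} : ComputableRatIn ∅ g ↔ RatComputable g := by
  rw [computableRatIn_iff]
  exact exists_congr fun r => and_congr_left' recursiveIn_empty_iff

theorem computableRatIn_of_prefix {X : ℕ → Bool} {G : List Bool × α → ℚ} {l : α → ℕ}
    (hG : RatComputable G) (hl : Computable l) :
    ComputableRatIn {seqOracle X} fun a => G (initSeg X (l a), a) := by
  obtain ⟨r, hr, h⟩ := hG
  exact computableRatIn_iff.2 ⟨_, computableIn_of_prefix hr hl, fun x => h _⟩

namespace RatComputable

theorem natCast {a : α → ℕ} (ha : Computable a) : RatComputable fun x => (a x : ℚ) :=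
  ⟨fun x => (a x, 0, 0), ha.pair (Computable.const _), fun x => by simp [ratVal]⟩

theorem const (q : ℚ) : RatComputable fun _ : α => q := by
  refine ⟨fun _ => (q.num.toNat, (-q.num).toNat, q.den - 1), Computable.const _, fun _ => ?_⟩
  have h1 : ((q.den - 1 : ℕ) : ℚ) + 1 = q.den := by
    rw [Nat.cast_sub q.den_pos]
    simp
  have h2 : ((q.num.toNat : ℕ) : ℚ) - ((-q.num).toNat : ℕ) = q.num := by
    exact_mod_cast congrArg (Int.cast (R := ℚ)) (Int.toNat_sub_toNat_neg q.num)
  simp only [ratVal]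
  rw [h1, h2, Rat.num_div_den]

theorem add {f g : α → ℚ} (hf : RatComputable f) (hg : RatComputable g) :
    RatComputable fun x => f x + g x := by
  obtain ⟨r, hr, hf⟩ := hf
  obtain ⟨s, hs, hg⟩ := hg
  exact ⟨_, primrec_addTriple.to_comp.comp hr hs, fun x => by simp only [hf, hg, ratVal_add]⟩

theorem mul {f g : α → ℚ} (hf : RatComputable f) (hg : RatComputable g) :
    RatComputable fun x => f x * g x := by
  obtain ⟨r, hr, hf⟩ := hf
  obtain ⟨s, hs, hg⟩ := hg
  exact ⟨_, primrec_mulTriple.to_comp.comp hr hs, fun x => by simp only [hf, hg, ratVal_mul]⟩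

theorem inv {f : α → ℚ} (hf : RatComputable f) : RatComputable fun x => (f x)⁻¹ := by
  obtain ⟨r, hr, hf⟩ := hf
  exact ⟨_, primrec_invTriple.to_comp.comp hr, fun x => by simp only [hf, ratVal_inv]⟩

theorem neg {f : α → ℚ} (hf : RatComputable f) : RatComputable fun x => -f x := by
  simpa using (const (-1)).mul hf

theorem sub {f g : α → ℚ} (hf : RatComputable f) (hg : RatComputable g) :
    RatComputable fun x => f x - g x := by
  simpa [sub_eq_add_neg] using hf.add hg.neg

theorem div {f g : α → ℚ} (hf : RatComputable f) (hg : RatComputable g) :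
    RatComputable fun x => f x / g x := by
  simpa [div_eq_mul_inv] using hf.mul hg.inv

theorem comp {f : β → ℚ} {g : α → β} (hf : RatComputable f) (hg : Computable g) :
    RatComputable fun x => f (g x) := by
  obtain ⟨r, hr, hf⟩ := hf
  exact ⟨_, hr.comp hg, fun x => hf _⟩

theorem cond {c : α → Bool} {f g : α → ℚ} (hc : Computable c) (hf : RatComputable f)
    (hg : RatComputable g) : RatComputable fun x => bif c x then f x else g x := by
  obtain ⟨r, hr, hf⟩ := hf
  obtain ⟨s, hs, hg⟩ := hg
  exact ⟨_, Computable.cond hc hr hs, fun x => by cases h : c x <;> simp [h, hf, hg]⟩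

theorem decide_nonneg {f : α → ℚ} (hf : RatComputable f) :
    Computable fun x => decide (0 ≤ f x) := by
  obtain ⟨r, hr, hf⟩ := hf
  have h1 : Computable fun r : ℕ × ℕ × ℕ => decide (r.2.1 ≤ r.1) :=
    (PrimrecRel.comp Primrec.nat_le (Primrec.fst.comp Primrec.snd) Primrec.fst).decide.to_comp
  refine (h1.comp hr).of_eq fun x => ?_
  rw [hf, ratVal, decide_eq_decide, le_div_iff₀ (by positivity), zero_mul, sub_nonneg,
    Nat.cast_le]

theorem fold {op : ℚ → ℚ → ℚ} {opTriple : ℕ × ℕ × ℕ → ℕ × ℕ × ℕ → ℕ × ℕ × ℕ}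
    (hop : Primrec₂ opTriple) (h : ∀ r s, ratVal (opTriple r s) = op (ratVal r) (ratVal s))
    {g : α × ℕ → ℚ} {n : α → ℕ} (hg : RatComputable g) (hn : Computable n) (q : ℚ) :
    RatComputable fun x => (Nat.rec q (fun i y => op y (g (x, i))) (n x) : ℚ) := by
  obtain ⟨r, hr, hg⟩ := hg
  obtain ⟨r₀, -, hq⟩ := const (α := ℕ) q
  refine ⟨fun x => Nat.rec (r₀ 0) (fun i y => opTriple y (r (x, i))) (n x), ?_, fun x => ?_⟩
  · refine Computable.nat_rec (h := fun x (y : ℕ × ℕ × ℕ × ℕ) => opTriple y.2 (r (x, y.1))) hn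
      (Computable.const _) (Computable₂.mk ?_)
    exact hop.to_comp.comp (Computable.snd.comp Computable.snd) (hr.comp
      (Computable.fst.pair (Computable.fst.comp Computable.snd)))
  · beta_reduce
    induction n x with
    | zero => exact hq 0
    | succ n ih =>
      change op _ (g (x, n)) = ratVal (opTriple _ (r (x, n)))
      rw [h, ← ih, hg]

theorem sum {g : α × ℕ → ℚ} {n : α → ℕ} (hg : RatComputable g) (hn : Computable n) :
    RatComputable fun x => ∑ i ∈ Finset.range (n x), g (x, i) := by
  convert fold primrec_addTriple ratVal_add hg hn 0 using 2 with x
  induction n x with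
  | zero => rfl
  | succ n ih => rw [Finset.sum_range_succ, ih]

theorem prod {g : α × ℕ → ℚ} {n : α → ℕ} (hg : RatComputable g) (hn : Computable n) :
    RatComputable fun x => ∏ i ∈ Finset.range (n x), g (x, i) := by
  convert fold primrec_mulTriple ratVal_mul hg hn 1 using 2 with x
  induction n x with
  | zero => rfl
  | succ n ih => rw [Finset.prod_range_succ, ih]

end RatComputable

end

/-! ### Approximating `p` from its binary expansion -/

/-- The rational number with the finite binary expansion `β`. -/
def binVal (β : List Bool) : ℚ :=
  ∑ i ∈ Finset.range β.length, (bif β.getD i false then 1 else 0) / ((2 ^ (i + 1) : ℕ) : ℚ)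

theorem ratComputable_binVal : RatComputable binVal := by
  refine RatComputable.sum (g := fun x : List Bool × ℕ =>
    (bif x.1.getD x.2 false then 1 else 0) / ((2 ^ (x.2 + 1) : ℕ) : ℚ)) ?_ Computable.list_length
  exact (RatComputable.cond (Primrec.list_getD false).to_comp (RatComputable.const 1)
    (RatComputable.const 0)).div (RatComputable.natCast (primrec_nat_pow.comp (Primrec.const 2)
      (Primrec.succ.comp Primrec.snd)).to_comp)

theorem binVal_bits (p : ℝ) (m : ℕ) : (binVal (initSeg (bits p) m) : ℝ) =
    ∑ i ∈ Finset.range m, Real.ofDigitsTerm (Real.digits p 2) i := by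
  simp only [binVal, length_initSeg]
  push_cast
  refine Finset.sum_congr rfl fun i hi => ?_
  rw [List.getD_eq_getElem?_getD, initSeg_getElem?, if_pos (Finset.mem_range.1 hi)]
  simp only [Option.getD_some, bits, Real.ofDigitsTerm, div_eq_mul_inv]
  congr 1
  have := (Real.digits p 2 i).isLt
  interval_cases h : (Real.digits p 2 i : ℕ)
  · have : Real.digits p 2 i = 0 := Fin.ext h
    simp [this]
  · have : Real.digits p 2 i = 1 := Fin.ext h
    simp [this]

theorem binVal_bits_le {p : ℝ} (hp : p ∈ Set.Ico (0 : ℝ) 1) (m : ℕ) :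
    (binVal (initSeg (bits p) m) : ℝ) ≤ p := by
  rw [binVal_bits]
  exact Real.sum_ofDigitsTerm_digits_le hp m

theorem le_binVal_bits {p : ℝ} (hp : p ∈ Set.Ico (0 : ℝ) 1) (m : ℕ) :
    p - (1 / 2) ^ m ≤ (binVal (initSeg (bits p) m) : ℝ) := by
  rw [binVal_bits]
  have := Real.le_sum_ofDigitsTerm_digits (b := 2) hp m
  rwa [Nat.cast_ofNat, ← one_div] at this

theorem binVal_nonneg (β : List Bool) : 0 ≤ binVal β := by
  refine Finset.sum_nonneg fun i _ => div_nonneg ?_ (by positivity)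
  cases β.getD i false <;> simp

/-! ### Bits of `p` from frequencies in blocks -/

/-- The largest `k` with `16 ^ k ≤ i + 1`. -/
def blockLevel (i : ℕ) : ℕ := Nat.findGreatest (fun k => 16 ^ k ≤ i + 1) i

theorem blockLevel_eq {i k : ℕ} (h1 : 16 ^ k ≤ i + 1) (h2 : i + 1 < 16 ^ (k + 1)) :
    blockLevel i = k := by
  have hk : k < 16 ^ k := Nat.lt_pow_self (by norm_num)
  refine Nat.findGreatest_eq_iff.2 ⟨by omega, fun _ => h1, fun l hl _ hc => ?_⟩
  have : 16 ^ (k + 1) ≤ 16 ^ l := Nat.pow_le_pow_right (by norm_num) hl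
  omega

/-- The locations of level `k` form the interval from 16^k - 1 up to, but not including, 16^(k+1) -
1, which has 15·16^k elements. -/
theorem blockLevel_block {k x : ℕ} (hx : x < 15 * 16 ^ k) : blockLevel (16 ^ k - 1 + x) = k := by
  have : 0 < 16 ^ k := by positivity
  exact blockLevel_eq (by omega) (by rw [pow_succ]; omega)

theorem blockEnd_eq (k : ℕ) : 16 ^ (k + 1) - 1 = 16 ^ k - 1 + 15 * 16 ^ k := by
  have : 0 < 16 ^ k := by positivity
  rw [pow_succ]
  omega

theorem primrec_blockLevel : Primrec blockLevel := by
  refine Primrec.nat_findGreatest (p := fun i k => 16 ^ k ≤ i + 1) Primrec.id ?_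
  exact PrimrecRel.comp Primrec.nat_le (primrec_nat_pow.comp (Primrec.const 16) Primrec.snd)
    (primrec_nat_add_one.comp Primrec.fst)

/-- The number of ones in a string. -/
def ones (β : List Bool) : ℕ := (β.filter (· = true)).length

theorem primrec_ones : Primrec ones :=
  Primrec.list_length.comp (Primrec.listFilter
    (PrimrecRel.comp Primrec.eq Primrec.id (Primrec.const true)))

/-- The number of ones in the block of level `k`. -/
def blockOnes (β : List Bool) (k : ℕ) : ℕ :=
  ones (β.take (16 ^ (k + 1) - 1)) - ones (β.take (16 ^ k - 1))

theorem primrec_blockOnes : Primrec₂ blockOnes := by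
  have h : Primrec fun x : List Bool × ℕ => ones (x.1.take (16 ^ x.2 - 1)) :=
    primrec_ones.comp (Primrec.list_take.comp (primrec_nat_sub_one.comp
      (primrec_nat_pow.comp (Primrec.const 16) Primrec.snd)) Primrec.fst)
  exact Primrec₂.mk (Primrec.nat_sub.comp (h.comp (Primrec.pair Primrec.fst
    (primrec_nat_add_one.comp Primrec.snd))) h)

/-- The integral part of `2 ^ (n + 1) p`, if `p` is determined well enough by the fact that
`15 * 16 ^ k * p` is `u` up to an error of `c * 8 ^ k`. -/
def floorOf (c : ℕ) (u k n : ℕ) : Option ℕ :=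
  let v := 2 ^ (n + 1) * u / (15 * 16 ^ k)
  -- With D = 15·16^k and e = c·8^k, the two tests ensure that the interval of possible values of
  -- 2^(n+1)·p, from 2^(n+1)(u - e)/D to 2^(n+1)(u + e)/D, lies in [v, v + 1). The error is added on
  -- the left so that no truncated subtraction occurs.
  if v * (15 * 16 ^ k) + 2 ^ (n + 1) * (c * 8 ^ k) ≤ 2 ^ (n + 1) * u then
    if 2 ^ (n + 1) * (u + c * 8 ^ k) + 1 ≤ (v + 1) * (15 * 16 ^ k) then some v else none
  else none

theorem primrec_floorOf {α : Type*} [Primcodable α] (c : ℕ) {u k n : α → ℕ} (hu : Primrec u)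
    (hk : Primrec k) (hn : Primrec n) : Primrec fun x => floorOf c (u x) (k x) (n x) := by
  have ht : Primrec fun x => 2 ^ (n x + 1) :=
    primrec_nat_pow.comp (Primrec.const 2) (primrec_nat_add_one.comp hn)
  have hd : Primrec fun x => 15 * 16 ^ k x :=
    Primrec.nat_mul.comp (Primrec.const 15) (primrec_nat_pow.comp (Primrec.const 16) hk)
  have he : Primrec fun x => c * 8 ^ k x :=
    Primrec.nat_mul.comp (Primrec.const c) (primrec_nat_pow.comp (Primrec.const 8) hk)
  have htu := Primrec.nat_mul.comp ht hu
  have hv := Primrec.nat_div.comp htu hd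
  exact Primrec.ite (PrimrecRel.comp Primrec.nat_le (Primrec.nat_add.comp
    (Primrec.nat_mul.comp hv hd) (Primrec.nat_mul.comp ht he)) htu)
    (Primrec.ite (PrimrecRel.comp Primrec.nat_le (primrec_nat_add_one.comp
      (Primrec.nat_mul.comp ht (Primrec.nat_add.comp hu he)))
      (Primrec.nat_mul.comp (primrec_nat_add_one.comp hv) hd))
      (Primrec.option_some.comp hv) (Primrec.const none)) (Primrec.const none)

theorem floorOf_sound {p : ℝ} {c u k n v : ℕ}
    (h : |(u : ℝ) - p * (15 * 16 ^ k)| ≤ (c : ℝ) * 8 ^ k) (hv : floorOf c u k n = some v) :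
    ⌊p * 2 ^ (n + 1)⌋₊ = v := by
  simp only [floorOf] at hv
  split_ifs at hv with h1 h2
  rw [Option.some.inj hv] at h1 h2
  have h1' : (v : ℝ) * (15 * 16 ^ k) + 2 ^ (n + 1) * (c * 8 ^ k) ≤ 2 ^ (n + 1) * u := by
    exact_mod_cast h1
  have h2' : (2 : ℝ) ^ (n + 1) * (u + c * 8 ^ k) + 1 ≤ (v + 1) * (15 * 16 ^ k) := by
    exact_mod_cast h2
  obtain ⟨h3, h4⟩ := abs_le.1 h
  have hD : (0 : ℝ) < 15 * 16 ^ k := by positivity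
  have ht : (0 : ℝ) < 2 ^ (n + 1) := by positivity
  generalize (2 : ℝ) ^ (n + 1) = t at *
  generalize (15 : ℝ) * 16 ^ k = D at *
  generalize (c : ℝ) * 8 ^ k = e at *
  have hlow : (v : ℝ) ≤ p * t := by
    refine le_of_mul_le_mul_right ?_ hD
    nlinarith
  have hupp : p * t < v + 1 := by
    refine lt_of_mul_lt_mul_right ?_ hD.le
    nlinarith
  exact (Nat.floor_eq_iff ((Nat.cast_nonneg v).trans hlow)).2 ⟨hlow, hupp⟩

/-- A non-integral 2^(n+1)·p has a positive distance to both neighbouring integers, while the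
relative error c·8^k / (15·16^k) tends to 0. At an integer the lower test could fail for every `k`.
-/
theorem floorOf_complete {p : ℝ} (hp : 0 ≤ p) (c n : ℕ)
    (hn : (⌊p * 2 ^ (n + 1)⌋₊ : ℝ) ≠ p * 2 ^ (n + 1)) :
    ∃ k, ∀ u : ℕ, |(u : ℝ) - p * (15 * 16 ^ k)| ≤ (c : ℝ) * 8 ^ k →
      floorOf c u k n = some ⌊p * 2 ^ (n + 1)⌋₊ := by
  have hw0 := Nat.floor_le (by positivity : 0 ≤ p * 2 ^ (n + 1))
  have hw2 := Nat.lt_floor_add_one (p * 2 ^ (n + 1))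
  generalize ⌊p * 2 ^ (n + 1)⌋₊ = w at *
  have hw1 : (w : ℝ) < p * 2 ^ (n + 1) :=
    lt_of_le_of_ne hw0 hn
  obtain ⟨δ, hδ, hδ1, hδ2⟩ : ∃ δ : ℝ, 0 < δ ∧ w + δ ≤ p * 2 ^ (n + 1) ∧
      p * 2 ^ (n + 1) + δ ≤ w + 1 := by
    refine ⟨min (p * 2 ^ (n + 1) - w) (w + 1 - p * 2 ^ (n + 1)), lt_min (by linarith)
      (by linarith), ?_, ?_⟩
    · linarith [min_le_left (p * 2 ^ (n + 1) - w) (w + 1 - p * 2 ^ (n + 1))]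
    · linarith [min_le_right (p * 2 ^ (n + 1) - w) (w + 1 - p * 2 ^ (n + 1))]
  -- In `2 * c + 1`, the term 2c pays for two errors c·8^k, that of `u` and that added by the test;
  -- the 1 pays for the `+ 1` in the strict test.
  obtain ⟨k, hk⟩ := exists_pow_lt_of_lt_one (div_pos hδ
    (by positivity : (0 : ℝ) < 2 ^ (n + 1) * (2 * c + 1))) (by norm_num : (1 / 2 : ℝ) < 1)
  refine ⟨k, fun u hu => ?_⟩
  have h8 : (1 / 2 : ℝ) ^ k * 16 ^ k = 8 ^ k := by rw [← mul_pow]; norm_num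
  have h8' : (1 : ℝ) ≤ 8 ^ k := one_le_pow₀ (by norm_num)
  rw [lt_div_iff₀ (by positivity)] at hk
  have h16 : (0 : ℝ) < 16 ^ k := by positivity
  have ht : (0 : ℝ) < 2 ^ (n + 1) := by positivity
  have key : (2 : ℝ) ^ (n + 1) * (2 * (c * 8 ^ k) + 8 ^ k) < δ * (15 * 16 ^ k) := by
    have := mul_lt_mul_of_pos_right hk h16
    calc (2 : ℝ) ^ (n + 1) * (2 * (c * 8 ^ k) + 8 ^ k)
        = (1 / 2 : ℝ) ^ k * (2 ^ (n + 1) * (2 * c + 1)) * 16 ^ k := by rw [← h8]; ring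
      _ < δ * 16 ^ k := this
      _ ≤ δ * (15 * 16 ^ k) := by nlinarith [mul_pos hδ h16]
  obtain ⟨h3, h4⟩ := abs_le.1 hu
  have he : (0 : ℝ) ≤ c * 8 ^ k := by positivity
  have ht1 : (1 : ℝ) ≤ 2 ^ (n + 1) := one_le_pow₀ (by norm_num)
  have hDpos : (0 : ℝ) < 15 * 16 ^ k := by positivity
  have hlow : (w : ℝ) * (15 * 16 ^ k) + 2 ^ (n + 1) * (c * 8 ^ k) ≤ 2 ^ (n + 1) * u := by
    generalize (2 : ℝ) ^ (n + 1) = t at *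
    generalize (15 : ℝ) * 16 ^ k = D at *
    generalize (c : ℝ) * 8 ^ k = e at *
    nlinarith
  have hupp : (2 : ℝ) ^ (n + 1) * (u + c * 8 ^ k) + 1 ≤ (w + 1) * (15 * 16 ^ k) := by
    generalize (2 : ℝ) ^ (n + 1) = t at *
    generalize (15 : ℝ) * 16 ^ k = D at *
    generalize (c : ℝ) * 8 ^ k = e at *
    nlinarith
  have hlow' : w * (15 * 16 ^ k) + 2 ^ (n + 1) * (c * 8 ^ k) ≤ 2 ^ (n + 1) * u := by
    exact_mod_cast hlow
  have hupp' : 2 ^ (n + 1) * (u + c * 8 ^ k) + 1 ≤ (w + 1) * (15 * 16 ^ k) := by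
    exact_mod_cast hupp
  have hv : 2 ^ (n + 1) * u / (15 * 16 ^ k) = w := by
    refine Nat.div_eq_of_lt_le (le_trans (Nat.le_add_right _ _) hlow') ?_
    calc 2 ^ (n + 1) * u ≤ 2 ^ (n + 1) * (u + c * 8 ^ k) :=
          Nat.mul_le_mul_left _ (Nat.le_add_right _ _)
      _ < _ := hupp'
  simp only [floorOf, hv]
  rw [if_pos hlow', if_pos hupp']

theorem bits_eq_of_floor {p : ℝ} {n v : ℕ} (h : ⌊p * 2 ^ (n + 1)⌋₊ = v) :
    bits p n = decide (v % 2 = 1) := by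
  unfold bits
  rw [decide_eq_decide]
  unfold Real.digits
  rw [Fin.ext_iff, Fin.val_ofNat]
  norm_num [h]

/-- From the place N + 1 on all bits are 0, so finitely many bits describe the expansion. This
covers the case that `floorOf_complete` excludes. -/
theorem computable_bits_of_dyadic {p : ℝ} {N : ℕ}
    (hN : (⌊p * 2 ^ (N + 1)⌋₊ : ℝ) = p * 2 ^ (N + 1)) : Computable (bits p) := by
  have hbits : ∀ n, bits p n = (initSeg (bits p) (N + 1)).getD n false := by
    intro n
    rw [List.getD_eq_getElem?_getD, initSeg_getElem?]
    split_ifs with h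
    · simp
    · obtain ⟨d, rfl⟩ := Nat.exists_eq_add_of_le (not_lt.1 h)
      have : ⌊p * 2 ^ (N + 1 + d + 1)⌋₊ = ⌊p * 2 ^ (N + 1)⌋₊ * 2 ^ d * 2 := by
        have h1 : p * 2 ^ (N + 1 + d + 1) = ((⌊p * 2 ^ (N + 1)⌋₊ * 2 ^ d * 2 : ℕ) : ℝ) := by
          push_cast
          rw [hN]
          ring
        rw [h1, Nat.floor_natCast]
      simp [bits_eq_of_floor this]
  exact ((Primrec.list_getD false).comp (Primrec.const (initSeg (bits p) (N + 1)))
    Primrec.id).to_comp.of_eq fun n => (hbits n).symm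

theorem initSeg_take (X : ℕ → Bool) {k l : ℕ} (h : k ≤ l) :
    (initSeg X l).take k = initSeg X k := by
  obtain ⟨t, ht⟩ := initSeg_prefix X h
  rw [← ht, List.take_append_of_le_length (by simp), List.take_of_length_le (by simp)]

/-- The `n`-th bit of `p`, if the frequency of the ones in the last block that `β` contains
determines it. -/
def bitOf (c : ℕ) (β : List Bool) (n : ℕ) : Option Bool :=
  -- This fails only for strings shorter than 15, where the level is 0, the subtraction truncates
  -- and no block is complete.
  if 16 ^ (blockLevel β.length - 1 + 1) - 1 ≤ β.length then
    (floorOf c (blockOnes β (blockLevel β.length - 1)) (blockLevel β.length - 1) n).map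
      fun v => decide (v % 2 = 1)
  else none

theorem primrec_bitOf (c : ℕ) : Primrec₂ (bitOf c) := by
  have hl : Primrec fun x : List Bool × ℕ => x.1.length := Primrec.list_length.comp Primrec.fst
  have hk : Primrec fun x : List Bool × ℕ => blockLevel x.1.length - 1 :=
    primrec_nat_sub_one.comp (primrec_blockLevel.comp hl)
  have hu : Primrec fun x : List Bool × ℕ => blockOnes x.1 (blockLevel x.1.length - 1) :=
    primrec_blockOnes.comp Primrec.fst hk
  have hfl : Primrec fun x : List Bool × ℕ =>
      floorOf c (blockOnes x.1 (blockLevel x.1.length - 1)) (blockLevel x.1.length - 1) x.2 :=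
    primrec_floorOf c hu hk Primrec.snd
  have hpow : Primrec fun x : List Bool × ℕ => 16 ^ (blockLevel x.1.length - 1 + 1) - 1 :=
    primrec_nat_sub_one.comp
      (primrec_nat_pow.comp (Primrec.const 16) (primrec_nat_add_one.comp hk))
  have hodd : Primrec fun v : ℕ => decide (v % 2 = 1) :=
    (PrimrecRel.comp Primrec.eq (Primrec.nat_mod.comp Primrec.id (Primrec.const 2))
      (Primrec.const 1)).decide
  have hle : PrimrecPred fun x : List Bool × ℕ =>
      16 ^ (blockLevel x.1.length - 1 + 1) - 1 ≤ x.1.length :=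
    PrimrecRel.comp Primrec.nat_le hpow hl
  have hmap : Primrec fun x : List Bool × ℕ =>
      (floorOf c (blockOnes x.1 (blockLevel x.1.length - 1)) (blockLevel x.1.length - 1) x.2).map
        fun v => decide (v % 2 = 1) := Primrec.option_map hfl (Primrec₂.mk (hodd.comp Primrec.snd))
  have hite := Primrec.ite hle hmap (Primrec.const none)
  unfold bitOf
  exact Primrec₂.mk hite

/-- If the frequencies of the ones in the blocks of `X` converge to `p` fast enough, then `X`
computes `p`. -/
theorem computesReal_of_blockOnes {X : ℕ → Bool} {p : ℝ} (hp : 0 ≤ p) (c : ℕ)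
    (h : ∀ k, |(blockOnes (initSeg X (16 ^ (k + 1) - 1)) k : ℝ) - p * (15 * 16 ^ k)| ≤
      (c : ℝ) * 8 ^ k) : ComputesReal X p := by
  -- The case distinction need not be effective: for the given `p` only the existence of an
  -- algorithm is claimed.
  by_cases hd : ∃ N : ℕ, (⌊p * 2 ^ (N + 1)⌋₊ : ℝ) = p * 2 ^ (N + 1)
  · obtain ⟨N, hN⟩ := hd
    exact (computable_bits_of_dyadic hN).computableIn
  push Not at hd
  have h16 : ∀ k, 16 ^ k - 1 ≤ 16 ^ (k + 1) - 1 := fun k => by rw [blockEnd_eq]; omega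
  refine computableIn_of_computable (primrec_bitOf c).to_comp ?_ ?_
  · intro n j b hb
    unfold bitOf at hb
    rw [length_initSeg] at hb
    generalize blockLevel j - 1 = k at hb
    rw [Option.ite_none_right_eq_some, Option.map_eq_some_iff] at hb
    obtain ⟨hj, v, hv, rfl⟩ := hb
    refine (bits_eq_of_floor (floorOf_sound ?_ hv)).symm
    have := h k
    unfold blockOnes at this ⊢
    rwa [initSeg_take X hj, initSeg_take X ((h16 k).trans hj), ← initSeg_take X le_rfl,
      ← initSeg_take X (h16 k)]
  · intro n
    obtain ⟨k, hk⟩ := floorOf_complete hp c n (hd n)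
    refine ⟨16 ^ (k + 1) - 1, ?_⟩
    -- Location 16^(k+1) - 1 is the first one of level k + 1, so a string of this length ends
    -- exactly with block `k`.
    have hl : blockLevel (16 ^ (k + 1) - 1) - 1 = k := by
      have := blockLevel_block (k := k + 1) (x := 0) (by positivity)
      rw [add_zero] at this
      rw [this, Nat.add_sub_cancel]
    unfold bitOf
    rw [length_initSeg, hl, if_pos le_rfl, hk _ (h k), Option.map_some, ← bits_eq_of_floor rfl]

/-! ### A martingale that detects deviations from the law of large numbers -/

/-- The weight of the bit at location `i`. -/
def wt (i : ℕ) : ℚ := 1 / ((8 ^ blockLevel i : ℕ) : ℚ)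

def wtSum (n : ℕ) : ℚ := ∑ i ∈ Finset.range n, wt i

def wtSqSum (n : ℕ) : ℚ := ∑ i ∈ Finset.range n, wt i * wt i

/-- The sum of the weights of the ones in `σ`. -/
def bitSum (σ : List Bool) : ℚ :=
  ∑ i ∈ Finset.range σ.length, (bif σ.getD i false then 1 else 0) * wt i

/-- The conditional expectation, given `σ`, of the square of the weighted sum of all deviations of
the bits from their mean `p`, plus a constant. -/
noncomputable def deviation (p : ℝ) (σ : List Bool) : ℝ :=
  ((bitSum σ : ℝ) - p * (wtSum σ.length : ℝ)) ^ 2 + p * (1 - p) * (20 - (wtSqSum σ.length : ℝ))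

theorem wt_pos (i : ℕ) : 0 < wt i := by unfold wt; positivity

theorem wt_le_one (i : ℕ) : wt i ≤ 1 := by
  unfold wt
  rw [div_le_one (by positivity)]
  exact_mod_cast Nat.one_le_pow _ _ (by norm_num)

theorem wtSum_nonneg (n : ℕ) : 0 ≤ wtSum n := Finset.sum_nonneg fun i _ => (wt_pos i).le

theorem wtSum_le (n : ℕ) : wtSum n ≤ n := by
  have := Finset.sum_le_card_nsmul (Finset.range n) wt 1 fun i _ => wt_le_one i
  simpa [wtSum] using this

theorem bitSum_nonneg (σ : List Bool) : 0 ≤ bitSum σ := by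
  refine Finset.sum_nonneg fun i _ => mul_nonneg ?_ (wt_pos i).le
  cases σ.getD i false <;> simp

theorem bitSum_le (σ : List Bool) : bitSum σ ≤ wtSum σ.length := by
  refine Finset.sum_le_sum fun i _ => mul_le_of_le_one_left (wt_pos i).le ?_
  cases σ.getD i false <;> simp

theorem wtSqSum_nonneg (n : ℕ) : 0 ≤ wtSqSum n :=
  Finset.sum_nonneg fun _ _ => mul_self_nonneg _

/-- Block k contributes 15·16^k·64^(-k) = 15·4^(-k), and these terms sum to 20. This is the constant
in `deviation`. -/
theorem wtSqSum_block (k : ℕ) : wtSqSum (16 ^ k - 1) = 20 * (1 - (1 / 4) ^ k) := by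
  induction k with
  | zero => simp [wtSqSum]
  | succ k ih =>
    have : ∀ x ∈ Finset.range (15 * 16 ^ k),
        wt (16 ^ k - 1 + x) * wt (16 ^ k - 1 + x) = (1 / 64) ^ k := by
      intro x hx
      rw [wt, blockLevel_block (Finset.mem_range.1 hx)]
      push_cast
      rw [one_div, ← mul_inv, ← mul_pow, one_div, inv_pow]
      norm_num
    unfold wtSqSum at ih ⊢
    rw [blockEnd_eq, Finset.sum_range_add, ih, Finset.sum_congr rfl this, Finset.sum_const,
      Finset.card_range, nsmul_eq_mul]
    push_cast
    rw [mul_assoc 15, ← mul_pow]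
    norm_num
    ring

theorem wtSqSum_le (n : ℕ) : wtSqSum n ≤ 20 := by
  have h1 : n ≤ 16 ^ n - 1 := by
    have : n < 16 ^ n := Nat.lt_pow_self (by norm_num)
    omega
  calc wtSqSum n ≤ wtSqSum (16 ^ n - 1) :=
        Finset.sum_le_sum_of_subset_of_nonneg (by simpa using h1) fun i _ _ => mul_self_nonneg _
    _ ≤ 20 := by
      rw [wtSqSum_block]
      have : (0 : ℚ) ≤ (1 / 4) ^ n := by positivity
      linarith

theorem bitSum_append (σ : List Bool) (b : Bool) :
    bitSum (σ ++ [b]) = bitSum σ + (bif b then 1 else 0) * wt σ.length := by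
  unfold bitSum
  rw [List.length_append, List.length_singleton, Finset.sum_range_succ]
  congr 1
  · refine Finset.sum_congr rfl fun i hi => ?_
    rw [List.getD_append _ _ _ _ (Finset.mem_range.1 hi)]
  · simp

theorem deviation_nonneg {p : ℝ} (hp0 : 0 ≤ p) (hp1 : p ≤ 1) (σ : List Bool) :
    0 ≤ deviation p σ := by
  have h1 : (wtSqSum σ.length : ℝ) ≤ 20 := by exact_mod_cast wtSqSum_le _
  have := mul_nonneg (mul_nonneg hp0 (sub_nonneg.2 hp1)) (sub_nonneg.2 h1)
  unfold deviation
  positivity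

/-- The next deviation has mean 0, so the cross term of the square vanishes; its variance p(1-p)w²
raises the expected square by just what the reserve p(1-p)(20 - Σw²) loses. -/
theorem deviation_fair (p : ℝ) (σ : List Bool) :
    deviation p σ = p * deviation p (σ ++ [true]) + (1 - p) * deviation p (σ ++ [false]) := by
  simp only [deviation, bitSum_append, List.length_append, List.length_singleton, wtSum, wtSqSum,
    Finset.sum_range_succ]
  push_cast
  simp
  ring

/-- The deviation is quadratic in p, so p - q factors out. The cofactor is at most 2b² + 20, where
the total weight b is at most the length of σ and hence at most 2^|σ|; the factor 2^5 covers 2 + 20.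
-/
theorem abs_deviation_sub_le {p q : ℝ} (hp0 : 0 ≤ p) (hp1 : p ≤ 1) (hq0 : 0 ≤ q) (hq1 : q ≤ 1)
    (σ : List Bool) : |deviation p σ - deviation q σ| ≤ |p - q| * 2 ^ (2 * σ.length + 5) := by
  have ha0 : (0 : ℝ) ≤ bitSum σ := by exact_mod_cast bitSum_nonneg σ
  have ha1 : (bitSum σ : ℝ) ≤ wtSum σ.length := by exact_mod_cast bitSum_le σ
  have hb0 : (0 : ℝ) ≤ wtSum σ.length := by exact_mod_cast wtSum_nonneg _
  have hb1 : (wtSum σ.length : ℝ) ≤ σ.length := by exact_mod_cast wtSum_le _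
  have hd0 : (0 : ℝ) ≤ wtSqSum σ.length := by exact_mod_cast wtSqSum_nonneg _
  have hd1 : (wtSqSum σ.length : ℝ) ≤ 20 := by exact_mod_cast wtSqSum_le _
  have hn : (σ.length : ℝ) ≤ 2 ^ σ.length := by exact_mod_cast Nat.lt_two_pow_self.le
  have h1 : (1 : ℝ) ≤ 2 ^ σ.length := one_le_pow₀ (by norm_num)
  unfold deviation
  generalize (bitSum σ : ℝ) = a at *
  generalize (wtSum σ.length : ℝ) = b at *
  generalize (wtSqSum σ.length : ℝ) = d at *
  have e : (2 : ℝ) ^ (2 * σ.length + 5) = 32 * (2 ^ σ.length) ^ 2 := by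
    rw [← pow_mul, pow_add, mul_comm 2]; norm_num; ring
  rw [e]
  generalize (2 : ℝ) ^ σ.length = n at *
  have hbn : b ≤ n := hb1.trans hn
  have key : (a - p * b) ^ 2 + p * (1 - p) * (20 - d) - ((a - q * b) ^ 2 + q * (1 - q) * (20 - d))
      = (p - q) * (b * ((p + q) * b - 2 * a) + (1 - p - q) * (20 - d)) := by ring
  rw [key, abs_mul]
  refine mul_le_mul_of_nonneg_left ?_ (abs_nonneg _)
  have h2 : |(p + q) * b - 2 * a| ≤ 2 * b := by
    rw [abs_le]
    constructor <;> nlinarith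
  have h3 : |1 - p - q| ≤ 1 := by rw [abs_le]; constructor <;> linarith
  calc |b * ((p + q) * b - 2 * a) + (1 - p - q) * (20 - d)|
      ≤ |b * ((p + q) * b - 2 * a)| + |(1 - p - q) * (20 - d)| := abs_add_le _ _
    _ = b * |(p + q) * b - 2 * a| + |1 - p - q| * (20 - d) := by
        rw [abs_mul, abs_mul, abs_of_nonneg hb0, abs_of_nonneg (by linarith : 0 ≤ 20 - d)]
    _ ≤ b * (2 * b) + 1 * 20 := by
        refine add_le_add (mul_le_mul_of_nonneg_left h2 hb0) ?_
        exact mul_le_mul h3 (by linarith) (by linarith) zero_le_one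
    _ ≤ 32 * n ^ 2 := by nlinarith

theorem ratComputable_wt : RatComputable wt :=
  (RatComputable.const 1).div (RatComputable.natCast (primrec_nat_pow.comp (Primrec.const 8)
    primrec_blockLevel).to_comp)

theorem ratComputable_wtSum : RatComputable wtSum :=
  RatComputable.sum (g := fun x : ℕ × ℕ => wt x.2) (ratComputable_wt.comp Computable.snd)
    Computable.id

theorem ratComputable_wtSqSum : RatComputable wtSqSum :=
  RatComputable.sum (g := fun x : ℕ × ℕ => wt x.2 * wt x.2)
    ((ratComputable_wt.mul ratComputable_wt).comp Computable.snd) Computable.id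

theorem ratComputable_bitSum : RatComputable bitSum := by
  refine RatComputable.sum (g := fun x : List Bool × ℕ =>
    (bif x.1.getD x.2 false then 1 else 0) * wt x.2) ?_ Computable.list_length
  exact (RatComputable.cond (Primrec.list_getD false).to_comp (RatComputable.const 1)
    (RatComputable.const 0)).mul (ratComputable_wt.comp Computable.snd)

theorem computableRealIn_deviation {p : ℝ} (hp0 : 0 < p) (hp1 : p < 1) :
    ComputableRealIn {seqOracle (bits p)} (deviation p) := by
  have hb : RatComputable fun x : List Bool × List Bool × ℕ => binVal x.1 :=
    ratComputable_binVal.comp Computable.fst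
  have hσ : Computable fun x : List Bool × List Bool × ℕ => x.2.1 :=
    Computable.fst.comp Computable.snd
  have hl : Computable fun x : List Bool × List Bool × ℕ => x.2.1.length :=
    Computable.list_length.comp hσ
  have hd := (ratComputable_bitSum.comp hσ).sub (hb.mul (ratComputable_wtSum.comp hl))
  have hG := (hd.mul hd).add ((hb.mul ((RatComputable.const 1).sub hb)).mul
    ((RatComputable.const 20).sub (ratComputable_wtSqSum.comp hl)))
  -- By `abs_deviation_sub_le` an error in `p` grows by a factor of at most 2^(2|σ| + 5), so this
  -- many further bits are read for precision 2^(-n).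
  have hlen : Computable fun x : List Bool × ℕ => 2 * x.1.length + 5 + x.2 :=
    (Primrec.nat_add.comp (Primrec.nat_add.comp (Primrec.nat_mul.comp (Primrec.const 2)
      (Primrec.list_length.comp Primrec.fst)) (Primrec.const 5)) Primrec.snd).to_comp
  refine ⟨_, computableRatIn_of_prefix (X := bits p) hG hlen, fun σ n => ?_⟩
  have hpI : p ∈ Set.Ico (0 : ℝ) 1 := ⟨hp0.le, hp1⟩
  set q := binVal (initSeg (bits p) (2 * σ.length + 5 + n)) with hq
  have hq0 : (0 : ℝ) ≤ q := by exact_mod_cast binVal_nonneg _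
  have hqp : (q : ℝ) ≤ p := binVal_bits_le hpI _
  have hpq : p - (1 / 2) ^ (2 * σ.length + 5 + n) ≤ q := le_binVal_bits hpI _
  have := abs_deviation_sub_le hp0.le hp1.le hq0 (hqp.trans hp1.le) σ
  rw [abs_of_nonneg (sub_nonneg.2 hqp)] at this
  have e : deviation q σ = (((bitSum σ - q * wtSum σ.length) * (bitSum σ - q * wtSum σ.length) +
      q * (1 - q) * (20 - wtSqSum σ.length) : ℚ) : ℝ) := by
    push_cast
    rw [deviation, sq]
  rw [← e]
  refine this.trans ?_
  calc (p - q) * 2 ^ (2 * σ.length + 5)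
      ≤ (1 / 2) ^ (2 * σ.length + 5 + n) * 2 ^ (2 * σ.length + 5) := by gcongr; linarith
    _ = (1 / 2) ^ n * ((1 / 2) * 2) ^ (2 * σ.length + 5) := by rw [pow_add, mul_pow]; ring
    _ = (1 / 2) ^ n := by norm_num

/-- The selection function that selects all bits in their order. -/
def selectAll : List Bool →. Bool × ℕ := fun σ => Part.some (true, σ.length)

theorem isSelection_selectAll : IsSelection selectAll := by
  intro σ ρ h hne a ha b hb
  obtain rfl := Part.mem_some_iff.1 ha
  obtain rfl := Part.mem_some_iff.1 hb
  exact fun h' => hne (h.eq_of_length h'.symm)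

theorem play_selectAll (X : ℕ → Bool) (k : ℕ) :
    play selectAll X k = Part.some (initSeg X k, initSeg X k) := by
  induction k with
  | zero => rfl
  | succ k ih => simp [play, ih, selectAll, initSeg_succ]

theorem recursiveIn_selectAll (O : Set (ℕ →. ℕ)) : RecursiveIn O selectAll :=
  Primrec.computableIn (f := fun σ : List Bool => (true, σ.length))
    ((Primrec.const true).pair Primrec.list_length)

theorem bitSum_block (X : ℕ → Bool) (k m : ℕ) (hm : m ≤ 15 * 16 ^ k) :
    bitSum (initSeg X (16 ^ k - 1 + m)) - bitSum (initSeg X (16 ^ k - 1)) =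
      ((ones (initSeg X (16 ^ k - 1 + m)) : ℚ) - ones (initSeg X (16 ^ k - 1))) / 8 ^ k := by
  induction m with
  | zero => simp
  | succ m ih =>
    have h1 := ih (by omega)
    rw [← add_assoc, initSeg_succ, bitSum_append, length_initSeg, wt,
      blockLevel_block (Nat.lt_of_succ_le hm)]
    rw [sub_eq_iff_eq_add] at h1
    rw [h1]
    cases X (16 ^ k - 1 + m) <;> simp [ones, List.filter_append]
    ring

theorem wtSum_block (k : ℕ) :
    wtSum (16 ^ (k + 1) - 1) - wtSum (16 ^ k - 1) = 15 * 16 ^ k / 8 ^ k := by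
  have : ∀ x ∈ Finset.range (15 * 16 ^ k), wt (16 ^ k - 1 + x) = 1 / 8 ^ k := by
    intro x hx
    rw [wt, blockLevel_block (Finset.mem_range.1 hx)]
    push_cast
    rfl
  unfold wtSum
  rw [blockEnd_eq, Finset.sum_range_add, Finset.sum_congr rfl this, Finset.sum_const,
    Finset.card_range, nsmul_eq_mul]
  push_cast
  ring

theorem ones_initSeg_mono (X : ℕ → Bool) {k l : ℕ} (h : k ≤ l) :
    ones (initSeg X k) ≤ ones (initSeg X l) :=
  ((initSeg_prefix X h).sublist.filter _).length_le

/-- Every `μ_p`-KL random sequence computes `p`. -/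
theorem KLRandom.computesReal {p : ℝ} (hp0 : 0 < p) (hp1 : p < 1) {X : ℕ → Bool}
    (hX : KLRandom p X) : ComputesReal X p := by
  obtain ⟨C, hC⟩ := hX selectAll (deviation p)
    ⟨isSelection_selectAll, deviation_nonneg hp0.le hp1.le, fun _ _ _ _ _ => deviation_fair p _⟩
    (recursiveIn_selectAll _) (computableRealIn_deviation hp0 hp1)
  -- As c ≥ 1, a square that is at most C is at most c², so its root is bounded by c itself.
  obtain ⟨c, hc⟩ := exists_nat_ge (max C 1)
  have hbound : ∀ k, |(bitSum (initSeg X k) : ℝ) - p * wtSum k| ≤ c := by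
    intro k
    have h1 : deviation p (initSeg X k) ≤ C := hC k (initSeg X k, initSeg X k)
      (by rw [play_selectAll]; exact Part.mem_some _)
    have h2 : (wtSqSum k : ℝ) ≤ 20 := by exact_mod_cast wtSqSum_le _
    have h3 := mul_nonneg (mul_nonneg hp0.le (sub_nonneg.2 hp1.le)) (sub_nonneg.2 h2)
    rw [deviation, length_initSeg] at h1
    have hc1 : (1 : ℝ) ≤ c := (le_max_right _ _).trans hc
    have hcC : C ≤ c := (le_max_left _ _).trans hc
    refine abs_le_of_sq_le_sq ?_ (by positivity)
    nlinarith
  -- A block is the difference of two initial segments, each contributing at most `c`; rescaling by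
  -- the constant weight of the block gives the factor 8^k.
  refine computesReal_of_blockOnes hp0.le (2 * c) fun k => ?_
  have h16 : 16 ^ k - 1 ≤ 16 ^ (k + 1) - 1 := by rw [blockEnd_eq]; omega
  have hu : (blockOnes (initSeg X (16 ^ (k + 1) - 1)) k : ℝ) =
      (ones (initSeg X (16 ^ (k + 1) - 1)) : ℝ) - ones (initSeg X (16 ^ k - 1)) := by
    rw [blockOnes, initSeg_take X le_rfl, initSeg_take X h16,
      Nat.cast_sub (ones_initSeg_mono X h16)]
  have h1 : ((bitSum (initSeg X (16 ^ (k + 1) - 1)) : ℚ) : ℝ) - bitSum (initSeg X (16 ^ k - 1)) =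
      ((ones (initSeg X (16 ^ (k + 1) - 1)) : ℝ) - ones (initSeg X (16 ^ k - 1))) / 8 ^ k := by
    have := bitSum_block X k _ le_rfl
    rw [← blockEnd_eq] at this
    exact_mod_cast congrArg (Rat.cast (K := ℝ)) this
  have h2 : ((wtSum (16 ^ (k + 1) - 1) : ℚ) : ℝ) - wtSum (16 ^ k - 1) =
      15 * 16 ^ k / 8 ^ k := by
    have := congrArg (Rat.cast (K := ℝ)) (wtSum_block k)
    push_cast at this
    exact this
  have h8 : (0 : ℝ) < 8 ^ k := by positivity
  rw [hu]
  have h3 : (ones (initSeg X (16 ^ (k + 1) - 1)) : ℝ) - ones (initSeg X (16 ^ k - 1)) -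
      p * (15 * 16 ^ k) = ((bitSum (initSeg X (16 ^ (k + 1) - 1)) - p * wtSum (16 ^ (k + 1) - 1)) -
        (bitSum (initSeg X (16 ^ k - 1)) - p * wtSum (16 ^ k - 1))) * 8 ^ k := by
    rw [eq_div_iff h8.ne'] at h1 h2
    linear_combination -h1 + p * h2
  rw [h3, abs_mul, abs_of_pos h8]
  refine mul_le_mul_of_nonneg_right ?_ h8.le
  push_cast
  exact (abs_sub _ _).trans (by linarith [hbound (16 ^ (k + 1) - 1), hbound (16 ^ k - 1)])

/-! ### KL random sequences are Hippocratic KL random -/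

theorem stakeFactor_nonneg {p : ℝ} (hp0 : 0 < p) (hp1 : p < 1) {s : ℚ} (hs : |s| ≤ 1) (b : Bool) :
    0 ≤ stakeFactor p s b := by
  have h1 : |(s : ℝ)| ≤ 1 := by exact_mod_cast hs
  have h2 : 0 ≤ |(s : ℝ)| / p := div_nonneg (abs_nonneg _) hp0.le
  have h3 : 0 ≤ |(s : ℝ)| / (1 - p) := div_nonneg (abs_nonneg _) (by linarith)
  unfold stakeFactor
  split_ifs <;> linarith

theorem stakeFactor_fair {p : ℝ} (hp0 : 0 < p) (hp1 : p < 1) (s : ℚ) :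
    p * stakeFactor p s true + (1 - p) * stakeFactor p s false = 1 := by
  have hp : p ≠ 0 := hp0.ne'
  have hp' : 1 - p ≠ 0 := by linarith
  unfold stakeFactor
  rcases le_or_gt 0 s with h | h
  · simp only [if_true, h, not_lt.2 h, if_false, Bool.false_eq_true]
    field_simp
    ring
  · simp only [if_true, h, not_le.2 h, if_false, Bool.false_eq_true]
    field_simp
    ring

theorem stakeMartingale_nonneg {p : ℝ} (hp0 : 0 < p) (hp1 : p < 1) {S : List Bool → ℚ}
    (hS : ∀ σ, |S σ| ≤ 1) (σ : List Bool) : 0 ≤ stakeMartingale p S σ :=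
  Finset.prod_nonneg fun _ _ => stakeFactor_nonneg hp0 hp1 (hS _) _

theorem stakeMartingale_fair {p : ℝ} (hp0 : 0 < p) (hp1 : p < 1) (S : List Bool → ℚ)
    (σ : List Bool) : stakeMartingale p S σ =
      p * stakeMartingale p S (σ ++ [true]) + (1 - p) * stakeMartingale p S (σ ++ [false]) := by
  rw [stakeMartingale_append, stakeMartingale_append]
  linear_combination (-stakeMartingale p S σ) * stakeFactor_fair hp0 hp1 (S σ)

theorem stakeMartingale_eq_prod_range (p : ℝ) (S : List Bool → ℚ) (σ : List Bool) :
    stakeMartingale p S σ =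
      ∏ i ∈ Finset.range σ.length, stakeFactor p (S (σ.take i)) (σ.getD i false) := by
  rw [Finset.prod_range]
  simp [stakeMartingale]

/-- The rational version of `stakeFactor`. -/
def ratFactor (q s : ℚ) (b : Bool) : ℚ :=
  bif decide (0 ≤ s) then 1 - s + (bif b then s / q else 0)
  else 1 + s + (bif b then 0 else -s / (1 - q))

theorem ratFactor_eq (q s : ℚ) (b : Bool) : (ratFactor q s b : ℝ) = stakeFactor q s b := by
  unfold ratFactor stakeFactor
  rcases le_or_gt 0 s with h | h
  · have h' : (0 : ℝ) ≤ s := by exact_mod_cast h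
    cases b <;> simp [h, not_lt.2 h, abs_of_nonneg h']
  · have h' : (s : ℝ) < 0 := by exact_mod_cast h
    cases b <;> simp [h, not_le.2 h, abs_of_neg h']

/-- Exchange the factors one at a time: each exchange costs at most δ times a product of the other
factors, which are bounded by K. -/
theorem abs_prod_sub_prod_le {K δ : ℝ} (hK : 1 ≤ K) (x y : ℕ → ℝ)
    (hx0 : ∀ i, 0 ≤ x i) (hx : ∀ i, x i ≤ K) (hy0 : ∀ i, 0 ≤ y i) (hy : ∀ i, y i ≤ K)
    (h : ∀ i, |x i - y i| ≤ δ) (n : ℕ) :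
    |∏ i ∈ Finset.range n, x i - ∏ i ∈ Finset.range n, y i| ≤ n * K ^ n * δ := by
  have hδ : 0 ≤ δ := (abs_nonneg _).trans (h 0)
  induction n with
  | zero => simp
  | succ n ih =>
    rw [Finset.prod_range_succ, Finset.prod_range_succ]
    set P := ∏ i ∈ Finset.range n, x i
    set Q := ∏ i ∈ Finset.range n, y i with hQ
    have hQ0 : 0 ≤ Q := Finset.prod_nonneg fun i _ => hy0 i
    have hQK : Q ≤ K ^ n := by
      have := Finset.prod_le_prod (s := Finset.range n) (fun i _ => hy0 i) fun i _ => hy i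
      simpa [hQ] using this
    have hKn : K ^ n ≤ K ^ (n + 1) := pow_le_pow_right₀ hK (Nat.le_succ n)
    calc |P * x n - Q * y n| = |(P - Q) * x n + Q * (x n - y n)| := by ring_nf
      _ ≤ |(P - Q) * x n| + |Q * (x n - y n)| := abs_add_le _ _
      _ = |P - Q| * x n + Q * |x n - y n| := by
        rw [abs_mul, abs_mul, abs_of_nonneg (hx0 n), abs_of_nonneg hQ0]
      _ ≤ n * K ^ n * δ * K + K ^ (n + 1) * δ := by
        refine add_le_add ?_ ?_
        · exact mul_le_mul ih (hx n) (hx0 n) (by positivity)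
        · exact mul_le_mul (hQK.trans hKn) (h n) (abs_nonneg _) (by positivity)
      _ = (n + 1 : ℕ) * K ^ (n + 1) * δ := by push_cast; ring

theorem stakeFactor_le {p K : ℝ} (hp0 : 0 < p) (hp1 : p < 1) (hK : 1 ≤ K) (h0 : 1 / p ≤ K)
    (h1 : 1 / (1 - p) ≤ K) {s : ℚ} (hs : |s| ≤ 1) (b : Bool) : stakeFactor p s b ≤ K := by
  have hs' : |(s : ℝ)| ≤ 1 := by exact_mod_cast hs
  have ha := abs_nonneg (s : ℝ)
  have e0 : |(s : ℝ)| / p ≤ |(s : ℝ)| * K := by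
    rw [div_eq_mul_one_div]; exact mul_le_mul_of_nonneg_left h0 ha
  have e1 : |(s : ℝ)| / (1 - p) ≤ |(s : ℝ)| * K := by
    rw [div_eq_mul_one_div]; exact mul_le_mul_of_nonneg_left h1 ha
  unfold stakeFactor
  split_ifs <;> nlinarith

theorem abs_stakeFactor_sub_le {p q K : ℝ} (hp0 : 0 < p) (hp1 : p < 1) (hq0 : 0 < q) (hq1 : q < 1)
    (hp : 1 / p ≤ K) (hp' : 1 / (1 - p) ≤ K) (hq : 1 / q ≤ K) (hq' : 1 / (1 - q) ≤ K)
    {s : ℚ} (hs : |s| ≤ 1) (b : Bool) :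
    |stakeFactor p s b - stakeFactor q s b| ≤ K ^ 2 * |p - q| := by
  have hs' : |(s : ℝ)| ≤ 1 := by exact_mod_cast hs
  have aux : ∀ {x y : ℝ}, 0 < x → 0 < y → 1 / x ≤ K → 1 / y ≤ K →
      |(|(s : ℝ)| / x - |(s : ℝ)| / y)| ≤ K ^ 2 * |x - y| := by
    intro x y hx hy hxK hyK
    have e : |(s : ℝ)| / x - |(s : ℝ)| / y = |(s : ℝ)| * ((1 / x) * (1 / y)) * (y - x) := by
      field_simp
    rw [e, abs_mul, abs_mul, abs_abs, abs_of_pos (by positivity : 0 < 1 / x * (1 / y)),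
      abs_sub_comm y x]
    refine mul_le_mul_of_nonneg_right ?_ (abs_nonneg _)
    have : 1 / x * (1 / y) ≤ K * K := mul_le_mul hxK hyK (by positivity) (by
      exact (by positivity : 0 ≤ 1 / x).trans hxK)
    calc |(s : ℝ)| * (1 / x * (1 / y)) ≤ 1 * (1 / x * (1 / y)) :=
          mul_le_mul_of_nonneg_right hs' (by positivity)
      _ ≤ K ^ 2 := by rw [one_mul, sq]; exact this
  have h0 : 0 ≤ K ^ 2 * |p - q| := by positivity
  unfold stakeFactor
  split_ifs
  · rw [add_sub_add_left_eq_sub]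
    exact aux hp0 hq0 hp hq
  · simpa using h0
  · rw [add_sub_add_left_eq_sub]
    refine (aux (by linarith) (by linarith) hp' hq').trans_eq ?_
    rw [sub_sub_sub_cancel_left, abs_sub_comm]
  · simpa using h0

theorem ratComputable_ratFactor {α : Type*} [Primcodable α] {q s : α → ℚ} {b : α → Bool}
    (hq : RatComputable q) (hs : RatComputable s) (hb : Computable b) :
    RatComputable fun x => ratFactor (q x) (s x) (b x) :=
  RatComputable.cond hs.decide_nonneg
    (((RatComputable.const 1).sub hs).add
      (RatComputable.cond hb (hs.div hq) (RatComputable.const 0)))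
    (((RatComputable.const 1).add hs).add
      (RatComputable.cond hb (RatComputable.const 0)
        (hs.neg.div ((RatComputable.const 1).sub hq))))

theorem computableRealIn_stakeMartingale {p : ℝ} (hp0 : 0 < p) (hp1 : p < 1) {S : List Bool → ℚ}
    (hS1 : ∀ σ, |S σ| ≤ 1) (hS : ComputableRatIn ∅ S) :
    ComputableRealIn {seqOracle (bits p)} (stakeMartingale p S) := by
  rw [computableRatIn_empty_iff] at hS
  -- The margin of 2 keeps p, 1 - p and their counterparts for every truncation of p to at least c
  -- bits above 2^(-c), so 2^c bounds all reciprocals.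
  obtain ⟨c, hc⟩ := exists_pow_lt_of_lt_one (half_pos (lt_min hp0 (sub_pos.2 hp1)))
    (by norm_num : (1 / 2 : ℝ) < 1)
  have hcp : 2 * (1 / 2 : ℝ) ^ c < p := by linarith [min_le_left p (1 - p)]
  have hcp' : 2 * (1 / 2 : ℝ) ^ c < 1 - p := by linarith [min_le_right p (1 - p)]
  have hσ : Computable fun x : (List Bool × List Bool × ℕ) × ℕ => x.1.2.1 :=
    Computable.fst.comp (Computable.snd.comp Computable.fst)
  have hi : Computable fun x : (List Bool × List Bool × ℕ) × ℕ => x.2 := Computable.snd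
  have hG : RatComputable fun x : List Bool × List Bool × ℕ =>
      ∏ i ∈ Finset.range x.2.1.length,
        ratFactor (binVal x.1) (S (x.2.1.take i)) (x.2.1.getD i false) := by
    refine RatComputable.prod (g := fun y : (List Bool × List Bool × ℕ) × ℕ =>
      ratFactor (binVal y.1.1) (S (y.1.2.1.take y.2)) (y.1.2.1.getD y.2 false)) ?_
      (Computable.list_length.comp (Computable.fst.comp Computable.snd))
    exact ratComputable_ratFactor
      (ratComputable_binVal.comp (Computable.fst.comp Computable.fst))
      (hS.comp (Primrec.list_take.to_comp.comp hi hσ))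
      ((Primrec.list_getD false).to_comp.comp hσ hi)
  -- The error is at most |σ|·2^(c|σ|)·2^(2c) times that of the truncation, and |σ| ≤ 2^|σ|; the
  -- number of bits cancels this and leaves 2^(-n).
  have hlen : Computable fun x : List Bool × ℕ => (c + 1) * x.1.length + 2 * c + x.2 :=
    (Primrec.nat_add.comp (Primrec.nat_add.comp (Primrec.nat_mul.comp (Primrec.const (c + 1))
      (Primrec.list_length.comp Primrec.fst)) (Primrec.const (2 * c))) Primrec.snd).to_comp
  refine ⟨_, computableRatIn_of_prefix (X := bits p) hG hlen, fun σ n => ?_⟩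
  have hpI : p ∈ Set.Ico (0 : ℝ) 1 := ⟨hp0.le, hp1⟩
  set m := (c + 1) * σ.length + 2 * c + n with hm
  set q := binVal (initSeg (bits p) m) with hq
  have hqp : (q : ℝ) ≤ p := binVal_bits_le hpI _
  have hpq : p - (1 / 2) ^ m ≤ q := le_binVal_bits hpI _
  have hmc : (1 / 2 : ℝ) ^ m ≤ (1 / 2) ^ c :=
    pow_le_pow_of_le_one (by norm_num) (by norm_num) (by rw [hm]; omega)
  have hc0 : (0 : ℝ) < (1 / 2) ^ c := by positivity
  have inv_le : ∀ {x : ℝ}, (1 / 2 : ℝ) ^ c ≤ x → 1 / x ≤ 2 ^ c := by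
    intro x hx
    calc 1 / x ≤ 1 / (1 / 2) ^ c := one_div_le_one_div_of_le hc0 hx
      _ = 2 ^ c := by rw [one_div_pow, one_div_one_div]
  have hq1 : (q : ℝ) < 1 := hqp.trans_lt hp1
  have hq0 : (0 : ℝ) < q := by linarith
  have K0 := inv_le (x := p) (by linarith)
  have K1 := inv_le (x := 1 - p) (by linarith)
  have K2 := inv_le (x := (q : ℝ)) (by linarith)
  have K3 := inv_le (x := 1 - (q : ℝ)) (by linarith)
  have hK : (1 : ℝ) ≤ 2 ^ c := one_le_pow₀ (by norm_num)
  have hnn : (σ.length : ℝ) ≤ 2 ^ σ.length := by exact_mod_cast Nat.lt_two_pow_self.le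
  rw [stakeMartingale_eq_prod_range]
  push_cast
  simp only [ratFactor_eq]
  refine (abs_prod_sub_prod_le (δ := (2 ^ c) ^ 2 * |p - q|) hK _ _
    (fun i => stakeFactor_nonneg hp0 hp1 (hS1 _) _)
    (fun i => stakeFactor_le hp0 hp1 hK K0 K1 (hS1 _) _)
    (fun i => stakeFactor_nonneg hq0 hq1 (hS1 _) _)
    (fun i => stakeFactor_le hq0 hq1 hK K2 K3 (hS1 _) _)
    (fun i => abs_stakeFactor_sub_le hp0 hp1 hq0 hq1 K0 K1 K2 K3 (hS1 _) _) _).trans ?_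
  rw [abs_of_nonneg (sub_nonneg.2 hqp)]
  calc (σ.length : ℝ) * (2 ^ c) ^ σ.length * ((2 ^ c) ^ 2 * (p - q))
      ≤ 2 ^ σ.length * (2 ^ c) ^ σ.length * ((2 ^ c) ^ 2 * (1 / 2) ^ m) := by
        gcongr
        linarith
    _ = (1 / 2) ^ n * ((1 / 2) * 2) ^ ((c + 1) * σ.length + 2 * c) := by
        rw [hm, mul_pow]
        ring
    _ = (1 / 2) ^ n := by norm_num

theorem KLRandom.hippocraticKLRandom {p : ℝ} (hp0 : 0 < p) (hp1 : p < 1) {X : ℕ → Bool}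
    (hX : KLRandom p X) : HippocraticKLRandom p X := fun f S hf hS1 hfc hS =>
  hX f (stakeMartingale p S)
    ⟨hf, stakeMartingale_nonneg hp0 hp1 hS1, fun _ _ _ _ _ => stakeMartingale_fair hp0 hp1 S _⟩
    (hfc.mono (Set.empty_subset _)) (computableRealIn_stakeMartingale hp0 hp1 hS1 hS)

/-! ### Halves of Hippocratic KL random sequences -/

/-- The bits of `X` at the locations `c`, `c + 2`, `c + 4`, … -/
def half (c : ℕ) (X : ℕ → Bool) : ℕ → Bool := fun i => X (2 * i + c)

/-- Renaming locations by n ↦ 2n + c is injective and computable, so a strategy against the half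
becomes a strategy against X with the same plays. -/
theorem HippocraticKLRandom.half {p : ℝ} {X : ℕ → Bool} (hX : HippocraticKLRandom p X) (c : ℕ) :
    HippocraticKLRandom p (half c X) := by
  intro f S hf hS1 hfc hS
  let g : List Bool →. Bool × ℕ := fun σ => (f σ).map fun a => (a.1, 2 * a.2 + c)
  have hplay : ∀ k, play g X k = play f (KLRand.half c X) k := by
    intro k
    induction k with
    | zero => rfl
    | succ k ih =>
      unfold play
      rw [ih]
      congr 1
  have hg : IsSelection g := by
    intro σ ρ h hne a ha b hb
    obtain ⟨a', ha', rfl⟩ := (Part.mem_map_iff _).1 ha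
    obtain ⟨b', hb', rfl⟩ := (Part.mem_map_iff _).1 hb
    have := hf σ ρ h hne a' ha' b' hb'
    dsimp only
    omega
  have hgc : RecursiveIn ∅ g := by
    have h : Primrec fun x : List Bool × Bool × ℕ => (x.2.1, 2 * x.2.2 + c) :=
      (Primrec.fst.comp Primrec.snd).pair (Primrec.nat_add.comp (Primrec.nat_mul.comp
        (Primrec.const 2) (Primrec.snd.comp Primrec.snd)) (Primrec.const c))
    rw [recursiveIn_empty_iff] at hfc ⊢
    exact hfc.map (Computable₂.mk h.to_comp)
  obtain ⟨C, hC⟩ := hX g S hg hS1 hgc hS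
  exact ⟨C, fun k vt h => hC k vt (by rwa [hplay])⟩

/-! ### Infinite runs of selection functions -/

/-- The infinite run of `f` on `X`: the strings `V k` and `T k` of the bits that `f` has seen and
selected, and the decision `(s k, n k)` that `f` takes next. -/
structure IsRun (f : List Bool →. Bool × ℕ) (X : ℕ → Bool) (V T : ℕ → List Bool) (s : ℕ → Bool)
    (n : ℕ → ℕ) : Prop where
  V_zero : V 0 = []
  T_zero : T 0 = []
  mem : ∀ k, (s k, n k) ∈ f (V k)
  V_succ : ∀ k, V (k + 1) = V k ++ [X (n k)]
  T_succ : ∀ k, T (k + 1) = if s k then T k ++ [X (n k)] else T k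

section

variable {f : List Bool →. Bool × ℕ} {X : ℕ → Bool}

theorem mem_play_succ {k : ℕ} {vt : List Bool × List Bool} :
    vt ∈ play f X (k + 1) ↔ ∃ ut ∈ play f X k, ∃ a ∈ f ut.1,
      (ut.1 ++ [X a.2], if a.1 then ut.2 ++ [X a.2] else ut.2) = vt := by
  simp only [play, Part.mem_bind_iff, Part.mem_map_iff]

theorem length_le_of_mem_play {k : ℕ} {vt : List Bool × List Bool} (h : vt ∈ play f X k) :
    vt.2.length ≤ k := by
  induction k generalizing vt with
  | zero =>
    obtain rfl := Part.mem_some_iff.1 h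
    simp
  | succ k ih =>
    obtain ⟨ut, hut, a, -, rfl⟩ := mem_play_succ.1 h
    have := ih hut
    dsimp only
    split_ifs
    · simpa using this
    · omega

theorem play_dom_mono {k l : ℕ} (hkl : k ≤ l) (h : (play f X l).Dom) : (play f X k).Dom := by
  induction l, hkl using Nat.le_induction with
  | base => exact h
  | succ l _ ih =>
    obtain ⟨vt, hvt⟩ := Part.dom_iff_mem.1 h
    obtain ⟨ut, hut, -⟩ := mem_play_succ.1 hvt
    exact ih (Part.dom_iff_mem.2 ⟨ut, hut⟩)

/-- Only finitely many strings have bounded length. The conclusion makes fairness available, which a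
KL martingale owes only where infinitely many bits are selected. -/
theorem selectsInfinitely_of_not_boundedAlong {M : List Bool → ℝ} (h : ¬ BoundedAlong f M X) :
    SelectsInfinitely f X := by
  by_contra hf
  unfold SelectsInfinitely at hf
  push Not at hf
  obtain ⟨m, hm⟩ := hf
  obtain ⟨C, hC⟩ := ((List.finite_length_lt Bool m).image M).bddAbove
  exact h ⟨C, fun k vt hvt => hC ⟨vt.2, hm k vt hvt, rfl⟩⟩

/-- Selecting k bits takes at least k steps, so every stage of the play is defined. -/
theorem SelectsInfinitely.exists_isRun (h : SelectsInfinitely f X) :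
    ∃ V T s n, IsRun f X V T s n ∧ ∀ k, (V k, T k) ∈ play f X k := by
  have hdom : ∀ k, (play f X k).Dom := by
    intro k
    obtain ⟨l, vt, hvt, hl⟩ := h k
    exact play_dom_mono (hl.trans (length_le_of_mem_play hvt)) (Part.dom_iff_mem.2 ⟨vt, hvt⟩)
  choose vt hvt using fun k => Part.dom_iff_mem.1 (hdom k)
  have hstep : ∀ k, ∃ a ∈ f (vt k).1, ((vt k).1 ++ [X a.2],
      if a.1 then (vt k).2 ++ [X a.2] else (vt k).2) = vt (k + 1) := by
    intro k
    obtain ⟨ut, hut, a, ha, e⟩ := mem_play_succ.1 (hvt (k + 1))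
    obtain rfl := Part.mem_unique hut (hvt k)
    exact ⟨a, ha, e⟩
  choose a ha e using hstep
  have h0 : vt 0 = ([], []) := Part.mem_some_iff.1 (hvt 0)
  exact ⟨fun k => (vt k).1, fun k => (vt k).2, fun k => (a k).1, fun k => (a k).2,
    ⟨by simp [h0], by simp [h0], ha, fun k => (congrArg Prod.fst (e k)).symm,
      fun k => (congrArg Prod.snd (e k)).symm⟩, hvt⟩

variable {V T : ℕ → List Bool} {s : ℕ → Bool} {n : ℕ → ℕ}

theorem IsRun.length_V (h : IsRun f X V T s n) (k : ℕ) : (V k).length = k := by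
  induction k with
  | zero => simp [h.V_zero]
  | succ k ih => simp [h.V_succ, ih]

theorem IsRun.V_prefix (h : IsRun f X V T s n) {k l : ℕ} (hkl : k ≤ l) : V k <+: V l := by
  induction l, hkl using Nat.le_induction with
  | base => exact List.prefix_refl _
  | succ l _ ih => exact ih.trans (by rw [h.V_succ]; exact List.prefix_append _ _)

theorem IsRun.n_ne (h : IsRun f X V T s n) (hf : IsSelection f) {k l : ℕ} (hkl : k < l) :
    n l ≠ n k :=
  hf (V k) (V l) (h.V_prefix hkl.le)
    (fun e => hkl.ne (by rw [← h.length_V k, ← h.length_V l, e])) _ (h.mem k) _ (h.mem l)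

end

/-! ### Rational stakes for real martingales -/

/-- The factor `stakeFactor`, for a real stake. -/
noncomputable def realFactor (p s : ℝ) (b : Bool) : ℝ :=
  1 - |s| + if b then max s 0 / p else max (-s) 0 / (1 - p)

theorem stakeFactor_eq_realFactor (p : ℝ) (s : ℚ) (b : Bool) :
    stakeFactor p s b = realFactor p s b := by
  unfold stakeFactor realFactor
  rcases le_or_gt 0 s with h | h
  · have h' : (0 : ℝ) ≤ s := by exact_mod_cast h
    cases b <;> simp [h, not_lt.2 h, abs_of_nonneg h', h']
  · have h' : (s : ℝ) < 0 := by exact_mod_cast h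
    cases b <;> simp [h, not_le.2 h, abs_of_neg h', h'.le]

/-- Shading a bet by t amounts to setting aside the fraction 1 - t of the capital. This reserve
later absorbs the rounding of the stake. -/
theorem realFactor_mul (p s : ℝ) {t : ℝ} (ht : 0 ≤ t) (b : Bool) :
    realFactor p (t * s) b = 1 - t + t * realFactor p s b := by
  have h : ∀ x : ℝ, max (t * x) 0 = t * max x 0 := fun x => by
    rw [← mul_zero t, ← mul_max_of_nonneg _ _ ht, mul_zero]
  unfold realFactor
  rw [abs_mul, abs_of_nonneg ht, h, ← mul_neg, h]
  split_ifs <;> ring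

theorem realFactor_lipschitz {p K : ℝ} (hp0 : 0 < p) (hp1 : p < 1) (hK : 1 ≤ K) (h0 : 1 / p ≤ K)
    (h1 : 1 / (1 - p) ≤ K) (s t : ℝ) (b : Bool) :
    |realFactor p s b - realFactor p t b| ≤ 2 * K * |s - t| := by
  have habs : |(|t| - |s|)| ≤ |s - t| := by
    rw [abs_sub_comm s t]; exact abs_abs_sub_abs_le t s
  have hmax : ∀ x y q : ℝ, 0 < q → 1 / q ≤ K →
      |max x 0 / q - max y 0 / q| ≤ K * |x - y| := by
    intro x y q hq hqK
    rw [← sub_div, abs_div, abs_of_pos hq, div_eq_mul_one_div, mul_comm]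
    exact mul_le_mul hqK (abs_max_sub_max_le_abs x y 0) (abs_nonneg _) (by linarith)
  have hd := abs_nonneg (s - t)
  unfold realFactor
  cases b
  · have := hmax (-s) (-t) (1 - p) (by linarith) h1
    rw [neg_sub_neg, abs_sub_comm t s] at this
    simp only [Bool.false_eq_true, if_false]
    calc |1 - |s| + max (-s) 0 / (1 - p) - (1 - |t| + max (-t) 0 / (1 - p))|
        = |(|t| - |s|) + (max (-s) 0 / (1 - p) - max (-t) 0 / (1 - p))| := by congr 1; ring
      _ ≤ |s - t| + K * |s - t| := (abs_add_le _ _).trans (add_le_add habs this)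
      _ ≤ 2 * K * |s - t| := by nlinarith
  · have := hmax s t p hp0 h0
    simp only [if_true]
    calc |1 - |s| + max s 0 / p - (1 - |t| + max t 0 / p)|
        = |(|t| - |s|) + (max s 0 / p - max t 0 / p)| := by congr 1; ring
      _ ≤ |s - t| + K * |s - t| := (abs_add_le _ _).trans (add_le_add habs this)
      _ ≤ 2 * K * |s - t| := by nlinarith

/-- The stake that turns a capital of `1` into `r₁` or `r₀`. -/
noncomputable def exactStake (r₁ r₀ : ℝ) : ℝ := max (1 - r₀) 0 - max (1 - r₁) 0

/-- Fairness puts 1 between the two ratios, so at most one of the positive parts is nonzero. The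
stake is what is lost on the unfavourable outcome, and fairness fixes the gain on the other one. -/
theorem realFactor_exactStake {p r₁ r₀ : ℝ} (hp0 : 0 < p) (hp1 : p < 1)
    (h : p * r₁ + (1 - p) * r₀ = 1) (b : Bool) :
    realFactor p (exactStake r₁ r₀) b = if b then r₁ else r₀ := by
  have hq : 0 < 1 - p := by linarith
  unfold realFactor exactStake
  rcases le_total r₀ 1 with h0 | h0
  · have h1 : 1 ≤ r₁ := by
      by_contra! h1
      nlinarith
    rw [max_eq_left (by linarith : 0 ≤ 1 - r₀), max_eq_right (by linarith : 1 - r₁ ≤ 0), sub_zero,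
      abs_of_nonneg (by linarith : 0 ≤ 1 - r₀), max_eq_left (by linarith : 0 ≤ 1 - r₀),
      max_eq_right (by linarith : -(1 - r₀) ≤ 0)]
    cases b
    · simp
    · simp only [if_true]
      field_simp
      linarith
  · have h1 : r₁ ≤ 1 := by
      by_contra! h1
      nlinarith
    rw [max_eq_left (by linarith : 0 ≤ 1 - r₁), max_eq_right (by linarith : 1 - r₀ ≤ 0), zero_sub,
      abs_neg, abs_of_nonneg (by linarith : 0 ≤ 1 - r₁), neg_neg,
      max_eq_left (by linarith : 0 ≤ 1 - r₁), max_eq_right (by linarith : -(1 - r₁) ≤ 0)]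
    cases b
    · simp only [Bool.false_eq_true, if_false]
      field_simp
      linarith
    · simp

/-- Positive parts are 1-Lipschitz. Writing the stake with them avoids deciding which ratio exceeds
1, a comparison of reals that is not computable in general. -/
theorem abs_exactStake_sub_le (r₁ r₀ r₁' r₀' : ℝ) :
    |exactStake r₁ r₀ - exactStake r₁' r₀'| ≤ |r₁ - r₁'| + |r₀ - r₀'| := by
  have h : ∀ x y : ℝ, |max (1 - x) 0 - max (1 - y) 0| ≤ |x - y| := fun x y => by
    refine (abs_max_sub_max_le_abs _ _ _).trans_eq ?_
    rw [sub_sub_sub_cancel_left, abs_sub_comm]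
  unfold exactStake
  calc |max (1 - r₀) 0 - max (1 - r₁) 0 - (max (1 - r₀') 0 - max (1 - r₁') 0)|
      = |(max (1 - r₀) 0 - max (1 - r₀') 0) - (max (1 - r₁) 0 - max (1 - r₁') 0)| := by
        congr 1; ring
    _ ≤ |r₀ - r₀'| + |r₁ - r₁'| := (abs_sub _ _).trans (add_le_add (h _ _) (h _ _))
    _ = _ := add_comm _ _

/-- The stake, shaded by the factor `2 ^ j / (2 ^ j + 1)`, that results from the approximations
`m`, `m₁` and `m₀` of multiples of the present capital and the capital after a `1` and a `0`. -/
def stakeTriple (j m m₁ m₀ : ℕ) : ℕ × ℕ × ℕ :=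
  (2 ^ j * (m - m₀), 2 ^ j * (m - m₁), m * (2 ^ j + 1) - 1)

/-- The truncated difference `m - a` is `m` times the positive part of 1 - a/m, so the triple
represents the shaded stake for the ratios exactly. -/
theorem ratVal_stakeTriple (j m₁ m₀ : ℕ) {m : ℕ} (hm : 0 < m) :
    (ratVal (stakeTriple j m m₁ m₀) : ℝ) =
      2 ^ j / (2 ^ j + 1) * exactStake ((m₁ : ℝ) / m) ((m₀ : ℝ) / m) := by
  have hm' : (0 : ℝ) < m := by exact_mod_cast hm
  have h1 : 1 ≤ m * (2 ^ j + 1) := Nat.mul_pos hm (Nat.succ_pos _)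
  have h : ∀ a : ℕ, ((m - a : ℕ) : ℝ) = m * max (1 - (a : ℝ) / m) 0 := by
    intro a
    rw [mul_max_of_nonneg _ _ hm'.le, mul_zero, mul_sub, mul_one, mul_div_cancel₀ _ hm'.ne']
    rcases le_total a m with ha | ha
    · rw [Nat.cast_sub ha, max_eq_left (sub_nonneg.2 (Nat.cast_le.2 ha))]
    · rw [Nat.sub_eq_zero_of_le ha, Nat.cast_zero, max_eq_right (sub_nonpos.2 (Nat.cast_le.2 ha))]
  simp only [ratVal, stakeTriple]
  push_cast [Nat.cast_sub h1]
  rw [h, h, exactStake]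
  field_simp
  ring

theorem abs_ratVal_stakeTriple_le (j m₁ m₀ : ℕ) {m : ℕ} (hm : 0 < m) :
    |ratVal (stakeTriple j m m₁ m₀)| ≤ 1 := by
  have h1 : 1 ≤ m * (2 ^ j + 1) := Nat.mul_pos hm (Nat.succ_pos _)
  have hle : ∀ a : ℕ, ((2 ^ j * (m - a) : ℕ) : ℚ) ≤ (m * (2 ^ j + 1) : ℕ) := fun a => by
    have : 2 ^ j * (m - a) ≤ m * (2 ^ j + 1) := by
      calc 2 ^ j * (m - a) ≤ 2 ^ j * m := Nat.mul_le_mul_left _ (Nat.sub_le _ _)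
        _ ≤ m * (2 ^ j + 1) := by rw [mul_add, mul_comm m]; omega
    exact_mod_cast this
  have hpos : (0 : ℚ) < (m * (2 ^ j + 1) : ℕ) := by exact_mod_cast h1
  have e : (((m * (2 ^ j + 1) - 1 : ℕ) : ℚ)) + 1 = (m * (2 ^ j + 1) : ℕ) := by
    rw [Nat.cast_sub h1]; simp
  unfold ratVal stakeTriple
  rw [e, abs_div, abs_of_pos hpos, div_le_one hpos]
  have h2 := hle m₀
  have h3 := hle m₁
  have h4 : (0 : ℚ) ≤ ((2 ^ j * (m - m₀) : ℕ) : ℚ) := Nat.cast_nonneg _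
  have h5 : (0 : ℚ) ≤ ((2 ^ j * (m - m₁) : ℕ) : ℚ) := Nat.cast_nonneg _
  exact abs_sub_le_iff.2 ⟨by dsimp only; linarith, by dsimp only; linarith⟩

theorem abs_div_sub_div_le {x y m a N K : ℝ} (hN : 0 < N) (hx : 1 ≤ x) (hm : N ≤ m) (hy : 0 ≤ y)
    (hxm : |N * x - m| ≤ 2) (hya : |N * y - a| ≤ 2) (hyx : y / x ≤ K) :
    |a / m - y / x| ≤ (2 + 2 * K) / N := by
  have hx0 : 0 < x := by linarith
  have hm0 : 0 < m := by linarith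
  have e : a / m - y / x = ((a - N * y) + (y / x) * (N * x - m)) / m := by
    field_simp
    ring
  have hr : 0 ≤ y / x := div_nonneg hy hx0.le
  rw [e, abs_div, abs_of_pos hm0]
  have h1 : |(a - N * y) + (y / x) * (N * x - m)| ≤ 2 + 2 * K := by
    refine (abs_add_le _ _).trans ?_
    rw [abs_sub_comm a, abs_mul, abs_of_nonneg hr]
    nlinarith [abs_nonneg (N * x - m)]
  exact div_le_div₀ ((abs_nonneg _).trans h1) h1 hN hm

/-- Betting the approximate stake, one does almost as well as the martingale. -/
theorem le_stakeFactor_stakeTriple {p K : ℝ} (hp0 : 0 < p) (hp1 : p < 1) (hK : 1 ≤ K)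
    (h0 : 1 / p ≤ K) (h1 : 1 / (1 - p) ≤ K) {x x₁ x₀ : ℝ} (hx : 1 ≤ x) (hx₁ : 0 ≤ x₁)
    (hx₀ : 0 ≤ x₀) (hfair : x = p * x₁ + (1 - p) * x₀) {j n m m₁ m₀ : ℕ} (hm : 2 ^ n ≤ m)
    (hn : 32 * K ^ 2 * 2 ^ j ≤ 2 ^ n)
    (hxm : |2 ^ n * x - (m : ℝ)| ≤ 2) (hxm₁ : |2 ^ n * x₁ - (m₁ : ℝ)| ≤ 2)
    (hxm₀ : |2 ^ n * x₀ - (m₀ : ℝ)| ≤ 2) (b : Bool) :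
    2 ^ j / (2 ^ j + 1) * ((if b then x₁ else x₀) / x) ≤
      stakeFactor p (ratVal (stakeTriple j m m₁ m₀)) b := by
  have hx0 : 0 < x := by linarith
  have hN : (0 : ℝ) < 2 ^ n := by positivity
  have hm' : (2 : ℝ) ^ n ≤ m := by exact_mod_cast hm
  have hmpos : 0 < m := lt_of_lt_of_le (by positivity) hm
  have hq : 0 < 1 - p := by linarith
  have hr : p * (x₁ / x) + (1 - p) * (x₀ / x) = 1 := by
    field_simp
    linarith
  have hr₁0 : 0 ≤ x₁ / x := by positivity
  have hr₀0 : 0 ≤ x₀ / x := by positivity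
  have hr₁ : x₁ / x ≤ K := by
    refine le_trans ?_ h0
    rw [le_div_iff₀ hp0]
    nlinarith
  have hr₀ : x₀ / x ≤ K := by
    refine le_trans ?_ h1
    rw [le_div_iff₀ hq]
    nlinarith
  set t : ℝ := 2 ^ j / (2 ^ j + 1) with ht
  have hj : (0 : ℝ) < 2 ^ j := by positivity
  have hj1 : (1 : ℝ) ≤ 2 ^ j := one_le_pow₀ (by norm_num)
  have ht0 : 0 ≤ t := by positivity
  have ht1 : 1 - t = 1 / (2 ^ j + 1) := by rw [ht]; field_simp; ring
  have htle : t ≤ 1 := by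
    have : 0 < 1 / ((2 : ℝ) ^ j + 1) := by positivity
    linarith
  rw [stakeFactor_eq_realFactor, ratVal_stakeTriple j m₁ m₀ hmpos]
  -- Each of the two ratios is off by at most (2 + 2K)/2^n ≤ 4K/2^n.
  have hdist : |t * exactStake ((m₁ : ℝ) / m) ((m₀ : ℝ) / m) - t * exactStake (x₁ / x) (x₀ / x)| ≤
      8 * K / 2 ^ n := by
    rw [← mul_sub, abs_mul, abs_of_nonneg ht0]
    have h2 := abs_exactStake_sub_le ((m₁ : ℝ) / m) ((m₀ : ℝ) / m) (x₁ / x) (x₀ / x)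
    have h3 := abs_div_sub_div_le hN hx hm' hx₁ hxm hxm₁ hr₁
    have h4 := abs_div_sub_div_le hN hx hm' hx₀ hxm hxm₀ hr₀
    have h5 : (2 + 2 * K) / 2 ^ n + (2 + 2 * K) / 2 ^ n ≤ 8 * K / 2 ^ n := by
      rw [← add_div]
      exact div_le_div_of_nonneg_right (by linarith) hN.le
    have h6 := abs_nonneg (exactStake ((m₁ : ℝ) / m) ((m₀ : ℝ) / m) - exactStake (x₁ / x) (x₀ / x))
    nlinarith
  have hlip := realFactor_lipschitz hp0 hp1 hK h0 h1
    (t * exactStake ((m₁ : ℝ) / m) ((m₀ : ℝ) / m)) (t * exactStake (x₁ / x) (x₀ / x)) b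
  rw [realFactor_mul p (exactStake (x₁ / x) (x₀ / x)) ht0, realFactor_exactStake hp0 hp1 hr] at hlip
  -- The reserve 1/(2^j + 1) covers the total error 16K²/2^n, because 2^n ≥ 32K²·2^j ≥ 16K²(2^j +
  -- 1).
  have herr : 2 * K * (8 * K / 2 ^ n) ≤ 1 - t := by
    rw [ht1, ← mul_div_assoc, div_le_div_iff₀ hN (by positivity)]
    have : (1 : ℝ) ≤ K ^ 2 := one_le_pow₀ hK
    nlinarith
  have hif : (if b then x₁ else x₀) / x = if b then x₁ / x else x₀ / x := by cases b <;> rfl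
  rw [hif]
  have h7 := (abs_le.1 hlip).1
  have h8 : 2 * K * |t * exactStake ((m₁ : ℝ) / m) ((m₀ : ℝ) / m) -
      t * exactStake (x₁ / x) (x₀ / x)| ≤ 2 * K * (8 * K / 2 ^ n) :=
    mul_le_mul_of_nonneg_left hdist (by linarith)
  linarith

/-- An approximation of `2 ^ n (M x + 1)`, if the triple `r` represents an approximation of `M x`
up to `2⁻ⁿ`. -/
def approxTriple (n : ℕ) (r : ℕ × ℕ × ℕ) : ℕ := 2 ^ n + 2 ^ n * (r.1 - r.2.1) / (r.2.2 + 1)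

/-- One unit of error comes from the approximation of y, one from the integer division. Replacing a
negative approximation by 0 only helps, as y ≥ 0. -/
theorem abs_sub_approxTriple_le {y : ℝ} (hy : 0 ≤ y) {n : ℕ} {r : ℕ × ℕ × ℕ}
    (h : |y - (ratVal r : ℝ)| ≤ (1 / 2) ^ n) :
    |2 ^ n * (y + 1) - (approxTriple n r : ℝ)| ≤ 2 := by
  have hN : (0 : ℝ) < 2 ^ n := by positivity
  set q : ℝ := ((r.1 - r.2.1 : ℕ) : ℝ) / ((r.2.2 : ℝ) + 1) with hq
  have hyq : |y - q| ≤ (1 / 2) ^ n := by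
    have hc : (0 : ℝ) < (r.2.2 : ℝ) + 1 := by positivity
    have hv : (ratVal r : ℝ) = ((r.1 : ℝ) - r.2.1) / ((r.2.2 : ℝ) + 1) := by
      rw [ratVal]; push_cast; rfl
    rcases le_total r.2.1 r.1 with hle | hle
    · rw [hq, Nat.cast_sub hle, ← hv]
      exact h
    · rw [hq, Nat.sub_eq_zero_of_le hle, Nat.cast_zero, zero_div, sub_zero, abs_of_nonneg hy]
      refine le_trans ?_ ((le_abs_self _).trans h)
      have : (ratVal r : ℝ) ≤ 0 := by
        rw [hv]
        have : (r.1 : ℝ) ≤ r.2.1 := by exact_mod_cast hle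
        exact div_nonpos_of_nonpos_of_nonneg (by linarith) hc.le
      linarith
  have hfl : |2 ^ n * q - ((2 ^ n * (r.1 - r.2.1) / (r.2.2 + 1) : ℕ) : ℝ)| ≤ 1 := by
    have e : (2 : ℝ) ^ n * q = ((2 ^ n * (r.1 - r.2.1) : ℕ) : ℝ) / ((r.2.2 + 1 : ℕ) : ℝ) := by
      rw [hq]; push_cast; ring
    rw [e, ← Nat.floor_div_eq_div (K := ℝ), abs_le]
    have h1 := Nat.floor_le (R := ℝ)
      (by positivity : 0 ≤ ((2 ^ n * (r.1 - r.2.1) : ℕ) : ℝ) / ((r.2.2 + 1 : ℕ) : ℝ))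
    have h2 := Nat.lt_floor_add_one (((2 ^ n * (r.1 - r.2.1) : ℕ) : ℝ) / ((r.2.2 + 1 : ℕ) : ℝ))
    constructor <;> linarith
  have hmul : |2 ^ n * y - 2 ^ n * q| ≤ 1 := by
    rw [← mul_sub, abs_mul, abs_of_pos hN]
    calc 2 ^ n * |y - q| ≤ 2 ^ n * (1 / 2) ^ n := mul_le_mul_of_nonneg_left hyq hN.le
      _ = 1 := by rw [← mul_pow]; norm_num
  rw [approxTriple]
  push_cast at hfl ⊢
  rw [abs_le] at *
  constructor <;> linarith [hfl.1, hfl.2, hmul.1, hmul.2]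

/-- The i-th factor is at least 1 - 2^(-(i+2)), and these defects sum to 1/2. The extra term
2^(-(n+1)) makes the induction go through. -/
theorem prod_shade_ge (n : ℕ) :
    (1 / 2 : ℝ) ≤ ∏ i ∈ Finset.range n, (2 : ℝ) ^ (i + 2) / (2 ^ (i + 2) + 1) := by
  suffices h : 1 / 2 + (1 / 2 : ℝ) ^ (n + 1) ≤
      ∏ i ∈ Finset.range n, (2 : ℝ) ^ (i + 2) / (2 ^ (i + 2) + 1) by
    have : (0 : ℝ) < (1 / 2) ^ (n + 1) := by positivity
    linarith
  induction n with
  | zero => norm_num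
  | succ n ih =>
    rw [Finset.prod_range_succ]
    have h1 : 1 - (1 / 2 : ℝ) ^ (n + 2) ≤ (2 : ℝ) ^ (n + 2) / (2 ^ (n + 2) + 1) := by
      rw [le_div_iff₀ (by positivity)]
      have e : (1 / 2 : ℝ) ^ (n + 2) * 2 ^ (n + 2) = 1 := by rw [← mul_pow]; norm_num
      have : (0 : ℝ) < (1 / 2) ^ (n + 2) := by positivity
      nlinarith
    have hx0 : (0 : ℝ) < (1 / 2) ^ n := by positivity
    have hx1 : (1 / 2 : ℝ) ^ n ≤ 1 := pow_le_one₀ (by norm_num) (by norm_num)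
    refine le_trans ?_ (mul_le_mul ih h1 ?_ ?_)
    · rw [pow_succ, pow_succ]
      nlinarith
    · rw [pow_succ, pow_succ]
      linarith
    · refine le_trans ?_ ih
      positivity

theorem primrec_approxTriple : Primrec₂ approxTriple := by
  have hn : Primrec fun x : ℕ × ℕ × ℕ × ℕ => 2 ^ x.1 :=
    primrec_nat_pow.comp (Primrec.const 2) Primrec.fst
  have ha : Primrec fun x : ℕ × ℕ × ℕ × ℕ => x.2.1 := Primrec.fst.comp Primrec.snd
  have hb : Primrec fun x : ℕ × ℕ × ℕ × ℕ => x.2.2.1 :=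
    Primrec.fst.comp (Primrec.snd.comp Primrec.snd)
  have hc : Primrec fun x : ℕ × ℕ × ℕ × ℕ => x.2.2.2 :=
    Primrec.snd.comp (Primrec.snd.comp Primrec.snd)
  exact Primrec₂.mk (Primrec.nat_add.comp hn (Primrec.nat_div.comp (Primrec.nat_mul.comp hn
    (Primrec.nat_sub.comp ha hb)) (primrec_nat_add_one.comp hc)))

theorem primrec_stakeTriple {α : Type*} [Primcodable α] {j m m₁ m₀ : α → ℕ} (hj : Primrec j)
    (hm : Primrec m) (hm₁ : Primrec m₁) (hm₀ : Primrec m₀) :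
    Primrec fun x => stakeTriple (j x) (m x) (m₁ x) (m₀ x) := by
  have h2 : Primrec fun x => 2 ^ j x := primrec_nat_pow.comp (Primrec.const 2) hj
  exact Primrec.pair (Primrec.nat_mul.comp h2 (Primrec.nat_sub.comp hm hm₀))
    (Primrec.pair (Primrec.nat_mul.comp h2 (Primrec.nat_sub.comp hm hm₁))
      (primrec_nat_sub_one.comp (Primrec.nat_mul.comp hm (primrec_nat_add_one.comp h2))))

/-- A computable nonnegative function has computable rational stakes with which one does, up to a
factor that tends to `1`, as well as the function wherever it is fair. -/
theorem exists_stake {p : ℝ} (hp0 : 0 < p) (hp1 : p < 1) {O : Set (ℕ →. ℕ)} {M : List Bool → ℝ}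
    (hM0 : ∀ σ, 0 ≤ M σ) (hM : ComputableRealIn O M) :
    ∃ S : List Bool → ℕ × ℕ × ℕ, ComputableIn O S ∧ (∀ σ, |ratVal (S σ)| ≤ 1) ∧
      ∀ σ, M σ = p * M (σ ++ [true]) + (1 - p) * M (σ ++ [false]) → ∀ b,
        (2 : ℝ) ^ (σ.length + 2) / (2 ^ (σ.length + 2) + 1) * (M (σ ++ [b]) + 1) ≤
          (M σ + 1) * stakeFactor p (ratVal (S σ)) b := by
  obtain ⟨q, hq, hMq⟩ := hM
  obtain ⟨r, hr, hqr⟩ := computableRatIn_iff.1 hq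
  set K := max (1 / p) (1 / (1 - p)) with hKdef
  have h0 : 1 / p ≤ K := le_max_left _ _
  have h1 : 1 / (1 - p) ≤ K := le_max_right _ _
  have hK : 1 ≤ K := le_trans (by rw [le_div_iff₀ hp0]; linarith) h0
  -- The `d` extra bits of precision absorb the constant 32K² required by
  -- `le_stakeFactor_stakeTriple`.
  obtain ⟨d, hd⟩ := pow_unbounded_of_one_lt (32 * K ^ 2) (by norm_num : (1 : ℝ) < 2)
  let A : List Bool → ℕ → ℕ := fun σ n => approxTriple n (r (σ, n))
  have hA : ∀ σ n, |2 ^ n * (M σ + 1) - (A σ n : ℝ)| ≤ 2 := fun σ n =>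
    abs_sub_approxTriple_le (hM0 σ) (by rw [← hqr]; exact hMq σ n)
  have hA1 : ∀ σ n, 2 ^ n ≤ A σ n := fun σ n => Nat.le_add_right _ _
  let prec : List Bool → ℕ := fun σ => d + (σ.length + 2)
  refine ⟨fun σ => stakeTriple (σ.length + 2) (A σ (prec σ)) (A (σ ++ [true]) (prec σ))
    (A (σ ++ [false]) (prec σ)), ?_, fun σ => abs_ratVal_stakeTriple_le _ _ _
      (lt_of_lt_of_le (by positivity) (hA1 _ _)), fun σ hfair b => ?_⟩
  · have hl2 : Primrec fun σ : List Bool => σ.length + 2 :=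
      Primrec.nat_add.comp Primrec.list_length (Primrec.const 2)
    have hprec : Primrec prec := Primrec.nat_add.comp (Primrec.const d) hl2
    have hAc : ∀ {g : List Bool → List Bool}, Primrec g →
        ComputableIn O fun σ => A (g σ) (prec σ) := by
      intro g hg
      exact ComputableIn.comp (f := fun x : ℕ × ℕ × ℕ × ℕ => approxTriple x.1 x.2)
        primrec_approxTriple.computableIn (ComputableIn.pair hprec.computableIn
          (ComputableIn.comp hr (hg.pair hprec).computableIn))
    have ht : ∀ b : Bool, Primrec fun σ : List Bool => σ ++ [b] := fun b =>
      Primrec.list_concat.comp Primrec.id (Primrec.const b)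
    have hF : Primrec fun x : ℕ × ℕ × ℕ × ℕ => stakeTriple x.1 x.2.1 x.2.2.1 x.2.2.2 :=
      primrec_stakeTriple Primrec.fst (Primrec.fst.comp Primrec.snd)
        (Primrec.fst.comp (Primrec.snd.comp Primrec.snd))
        (Primrec.snd.comp (Primrec.snd.comp Primrec.snd))
    exact ComputableIn.comp hF.computableIn (ComputableIn.pair hl2.computableIn
      (ComputableIn.pair (hAc Primrec.id) (ComputableIn.pair (hAc (ht true)) (hAc (ht false)))))
  · have hpos : 0 < M σ + 1 := by linarith [hM0 σ]
    have hn : 32 * K ^ 2 * 2 ^ (σ.length + 2) ≤ 2 ^ prec σ := by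
      rw [show prec σ = d + (σ.length + 2) from rfl, pow_add 2 d]
      exact mul_le_mul_of_nonneg_right hd.le (by positivity)
    -- The stakes follow M + 1, which is fair where M is and is at least 1, so that dividing by the
    -- capital is harmless even where M vanishes.
    have key := le_stakeFactor_stakeTriple hp0 hp1 hK h0 h1 (x := M σ + 1)
      (x₁ := M (σ ++ [true]) + 1) (x₀ := M (σ ++ [false]) + 1) (by linarith [hM0 σ])
      (by linarith [hM0 (σ ++ [true])]) (by linarith [hM0 (σ ++ [false])])
      (by rw [hfair]; ring) (hA1 σ (prec σ)) hn (hA _ _) (hA _ _) (hA _ _) b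
    have hb : (if b then M (σ ++ [true]) + 1 else M (σ ++ [false]) + 1) = M (σ ++ [b]) + 1 := by
      cases b <;> rfl
    rw [hb, ← mul_div_assoc, div_le_iff₀ hpos, mul_comm _ (M σ + 1)] at key
    exact key

/-! ### Selection functions that select everything they read -/

/-- The selection function that reads at location `h σ` and selects, as long as it has not been at
this location before. -/
def selectAt (h : List Bool → ℕ) : List Bool →. Bool × ℕ := fun σ =>
  ((if ∃ i ∈ List.range σ.length, h (σ.take i) = h σ then none else some (true, h σ) :
    Option (Bool × ℕ)) : Part (Bool × ℕ))

theorem mem_selectAt {h : List Bool → ℕ} {σ : List Bool} {a : Bool × ℕ} :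
    a ∈ selectAt h σ ↔ (∀ i < σ.length, h (σ.take i) ≠ h σ) ∧ a = (true, h σ) := by
  unfold selectAt
  rw [Part.mem_coe, Option.mem_def, Option.ite_none_left_eq_some, Option.some_inj]
  simp [eq_comm]

/-- The guard against repeated locations gives this for every `h`; that `h` does not repeat itself
has to be shown only along the run at hand. -/
theorem isSelection_selectAt (h : List Bool → ℕ) : IsSelection (selectAt h) := by
  intro σ ρ hσρ hne a ha b hb
  obtain ⟨-, rfl⟩ := mem_selectAt.1 ha
  obtain ⟨hb', rfl⟩ := mem_selectAt.1 hb
  have hlt : σ.length < ρ.length :=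
    lt_of_le_of_ne hσρ.length_le fun e => hne (hσρ.eq_of_length e)
  have := hb' σ.length hlt
  rw [← List.prefix_iff_eq_take.1 hσρ] at this
  exact this.symm

theorem recursiveIn_selectAt {h : List Bool → ℕ} (hh : Primrec h) :
    RecursiveIn ∅ (selectAt h) := by
  rw [recursiveIn_empty_iff]
  refine Computable.ofOption (Primrec.to_comp ?_)
  have hR : PrimrecRel fun (i : ℕ) (σ : List Bool) => h (σ.take i) = h σ :=
    PrimrecRel.comp Primrec.eq (hh.comp (Primrec.list_take.comp Primrec.fst Primrec.snd))
      (hh.comp Primrec.snd)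
  exact Primrec.ite (PrimrecRel.comp (PrimrecRel.exists_mem_list hR)
    (Primrec.list_range.comp Primrec.list_length) Primrec.id) (Primrec.const none)
    (Primrec.option_some.comp ((Primrec.const true).pair hh))

/-- The string of the first `j` bits of `X` that are read at the locations given by `h`. -/
def readBits (h : List Bool → ℕ) (X : ℕ → Bool) : ℕ → List Bool
  | 0 => []
  | j + 1 => readBits h X j ++ [X (h (readBits h X j))]

@[simp] theorem length_readBits (h : List Bool → ℕ) (X : ℕ → Bool) (j : ℕ) :
    (readBits h X j).length = j := by
  induction j with
  | zero => rfl
  | succ j ih => simp [readBits, ih]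

theorem readBits_take (h : List Bool → ℕ) (X : ℕ → Bool) {i j : ℕ} (hij : i ≤ j) :
    (readBits h X j).take i = readBits h X i := by
  induction j, hij using Nat.le_induction with
  | base => exact List.take_of_length_le (by simp)
  | succ j hj ih => rw [readBits, List.take_append_of_le_length (by simpa using hj), ih]

theorem play_selectAt {h : List Bool → ℕ} {X : ℕ → Bool}
    (hinj : ∀ i j, i < j → h (readBits h X i) ≠ h (readBits h X j)) (j : ℕ) :
    play (selectAt h) X j = Part.some (readBits h X j, readBits h X j) := by
  induction j with
  | zero => rfl
  | succ j ih =>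
    have hmem : selectAt h (readBits h X j) = Part.some (true, h (readBits h X j)) := by
      refine Part.eq_some_iff.2 (mem_selectAt.2 ⟨fun i hi => ?_, rfl⟩)
      rw [length_readBits] at hi
      rw [readBits_take h X hi.le]
      exact hinj i j hi
    rw [play, ih, Part.bind_some, hmem, Part.map_some]
    rfl

/-! ### The simulation -/

/-- The instruction of `f` for the string `V` and the stake for the string `T`, as far as the known
part `β` of the oracle determines them. -/
def instruction (F : List Bool → List Bool → Option (Bool × ℕ))
    (G : List Bool → List Bool → Option (ℕ × ℕ × ℕ)) (x : List Bool × List Bool × List Bool) :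
    Option ((Bool × ℕ) × ℕ × ℕ × ℕ) :=
  (F x.1 x.2.1).bind fun a => (G x.1 x.2.2).map fun r => (a, r)

/-- Reading one bit in the simulated run. -/
def advance (a : Bool × ℕ) (VT : List Bool × List Bool) (b : Bool) : List Bool × List Bool :=
  (VT.1 ++ [b], bif a.1 then VT.2 ++ [b] else VT.2)

/-- The location where the simulation reads: the location that `f` asks for, if this is known and
not of the parity `c` of the oracle, and otherwise the first unknown bit of the oracle. -/
def simLoc (c : ℕ) (β : List Bool) : Option ((Bool × ℕ) × ℕ × ℕ × ℕ) → ℕ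
  | none => 2 * β.length + c
  | some a => if a.1.2 % 2 = c then 2 * β.length + c else a.1.2

/-- The stake of the simulation. -/
def simStake (c : ℕ) : Option ((Bool × ℕ) × ℕ × ℕ × ℕ) → ℕ × ℕ × ℕ
  | none => (0, 0, 0)
  | some a => if a.1.1 = true ∧ a.1.2 % 2 ≠ c then a.2 else (0, 0, 0)

/-- The next state of the simulation. -/
def simStep (c : ℕ) (x : List Bool × List Bool × List Bool) (b : Bool) :
    Option ((Bool × ℕ) × ℕ × ℕ × ℕ) → List Bool × List Bool × List Bool
  | none => (x.1 ++ [b], x.2)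
  | some a => if a.1.2 % 2 = c then
      -- Location 2i + c holds bit i of the oracle. If that bit was already known, the simulated run
      -- advances with it; the new bit is stored in any case, since each step has to read a fresh
      -- location.
      (x.1 ++ [b], (x.1[a.1.2 / 2]?).elim x.2 fun b' => advance a.1 x.2 b')
    else (x.1, advance a.1 x.2 b)

/-- The state of the simulation after the bits of `σ` have been read. -/
def simState (F : List Bool → List Bool → Option (Bool × ℕ))
    (G : List Bool → List Bool → Option (ℕ × ℕ × ℕ)) (c : ℕ) (σ : List Bool) :
    List Bool × List Bool × List Bool :=
  σ.foldl (fun x b => simStep c x b (instruction F G x)) ([], [], [])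

/-! ### Primitive recursiveness of the simulation -/

section Primrec

variable {F : List Bool → List Bool → Option (Bool × ℕ)}
  {G : List Bool → List Bool → Option (ℕ × ℕ × ℕ)}

theorem primrec_instruction (hF : Primrec₂ F) (hG : Primrec₂ G) : Primrec (instruction F G) := by
  have h : Primrec fun y : (List Bool × List Bool × List Bool) × Bool × ℕ =>
      (G y.1.1 y.1.2.2).map fun r => (y.2, r) :=
    Primrec.option_map (hG.comp (Primrec.fst.comp Primrec.fst)
      (Primrec.snd.comp (Primrec.snd.comp Primrec.fst)))
      (Primrec₂.mk ((Primrec.snd.comp Primrec.fst).pair Primrec.snd))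
  exact Primrec.option_bind (hF.comp Primrec.fst (Primrec.fst.comp Primrec.snd)) (Primrec₂.mk h)

theorem primrec_advance {α : Type*} [Primcodable α] {a : α → Bool × ℕ}
    {VT : α → List Bool × List Bool} {b : α → Bool} (ha : Primrec a) (hVT : Primrec VT)
    (hb : Primrec b) : Primrec fun x => advance (a x) (VT x) (b x) := by
  have h2 := Primrec.snd.comp hVT
  exact (Primrec.list_concat.comp (Primrec.fst.comp hVT) hb).pair
    (Primrec.cond (Primrec.fst.comp ha) (Primrec.list_concat.comp h2 hb) h2)

theorem primrec_simLoc {α : Type*} [Primcodable α] (c : ℕ) {β : α → List Bool}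
    {o : α → Option ((Bool × ℕ) × ℕ × ℕ × ℕ)} (hβ : Primrec β) (ho : Primrec o) :
    Primrec fun x => simLoc c (β x) (o x) := by
  have hl : Primrec fun x => 2 * (β x).length + c := Primrec.nat_add.comp (Primrec.nat_mul.comp
    (Primrec.const 2) (Primrec.list_length.comp hβ)) (Primrec.const c)
  have hn : Primrec fun y : α × (Bool × ℕ) × ℕ × ℕ × ℕ => y.2.1.2 :=
    Primrec.snd.comp (Primrec.fst.comp Primrec.snd)
  have h : Primrec fun y : α × (Bool × ℕ) × ℕ × ℕ × ℕ =>
      if y.2.1.2 % 2 = c then 2 * (β y.1).length + c else y.2.1.2 :=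
    Primrec.ite (PrimrecRel.comp Primrec.eq (Primrec.nat_mod.comp hn (Primrec.const 2))
      (Primrec.const c)) (hl.comp Primrec.fst) hn
  refine (Primrec.option_casesOn ho hl h.to₂).of_eq fun x => ?_
  cases o x <;> rfl

theorem primrec_simStake (c : ℕ) : Primrec (simStake c) := by
  have hn : Primrec fun y : Option ((Bool × ℕ) × ℕ × ℕ × ℕ) × (Bool × ℕ) × ℕ × ℕ × ℕ => y.2.1.2 :=
    Primrec.snd.comp (Primrec.fst.comp Primrec.snd)
  have h : Primrec fun y : Option ((Bool × ℕ) × ℕ × ℕ × ℕ) × (Bool × ℕ) × ℕ × ℕ × ℕ =>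
      if y.2.1.1 = true ∧ y.2.1.2 % 2 ≠ c then y.2.2 else (0, 0, 0) :=
    Primrec.ite (PrimrecPred.and
      (PrimrecRel.comp Primrec.eq (Primrec.fst.comp (Primrec.fst.comp Primrec.snd))
        (Primrec.const true))
      (PrimrecPred.not (PrimrecRel.comp Primrec.eq (Primrec.nat_mod.comp hn (Primrec.const 2))
        (Primrec.const c)))) (Primrec.snd.comp Primrec.snd) (Primrec.const _)
  refine (Primrec.option_casesOn Primrec.id (Primrec.const (0, 0, 0)) h.to₂).of_eq
    fun x => ?_
  cases x <;> rfl

theorem primrec_simStep {α : Type*} [Primcodable α] (c : ℕ)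
    {x : α → List Bool × List Bool × List Bool} {b : α → Bool}
    {o : α → Option ((Bool × ℕ) × ℕ × ℕ × ℕ)} (hx : Primrec x) (hb : Primrec b) (ho : Primrec o) :
    Primrec fun y => simStep c (x y) (b y) (o y) := by
  have hβ : Primrec fun y => (x y).1 ++ [b y] :=
    Primrec.list_concat.comp (Primrec.fst.comp hx) hb
  have hVT : Primrec fun y => (x y).2 := Primrec.snd.comp hx
  have ha : Primrec fun y : α × (Bool × ℕ) × ℕ × ℕ × ℕ => y.2.1 := Primrec.fst.comp Primrec.snd
  have hn : Primrec fun y : α × (Bool × ℕ) × ℕ × ℕ × ℕ => y.2.1.2 := Primrec.snd.comp ha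
  have hget : Primrec fun y : α × (Bool × ℕ) × ℕ × ℕ × ℕ => (x y.1).1[y.2.1.2 / 2]? :=
    Primrec.list_getElem?.comp (Primrec.fst.comp (hx.comp Primrec.fst))
      (Primrec.nat_div.comp hn (Primrec.const 2))
  have hadv : Primrec fun y : (α × (Bool × ℕ) × ℕ × ℕ × ℕ) × Bool =>
      advance y.1.2.1 (x y.1.1).2 y.2 :=
    primrec_advance (ha.comp Primrec.fst) (hVT.comp (Primrec.fst.comp Primrec.fst)) Primrec.snd
  have helim : Primrec fun y : α × (Bool × ℕ) × ℕ × ℕ × ℕ =>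
      ((x y.1).1[y.2.1.2 / 2]?).elim (x y.1).2 fun b' => advance y.2.1 (x y.1).2 b' := by
    refine (Primrec.option_casesOn hget (hVT.comp Primrec.fst) hadv.to₂).of_eq
      fun y => ?_
    cases (x y.1).1[y.2.1.2 / 2]? <;> rfl
  have h : Primrec fun y : α × (Bool × ℕ) × ℕ × ℕ × ℕ => if y.2.1.2 % 2 = c then
      ((x y.1).1 ++ [b y.1],
        ((x y.1).1[y.2.1.2 / 2]?).elim (x y.1).2 fun b' => advance y.2.1 (x y.1).2 b')
      else ((x y.1).1, advance y.2.1 (x y.1).2 (b y.1)) :=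
    Primrec.ite (PrimrecRel.comp Primrec.eq (Primrec.nat_mod.comp hn (Primrec.const 2))
      (Primrec.const c)) ((hβ.comp Primrec.fst).pair helim)
      ((Primrec.fst.comp (hx.comp Primrec.fst)).pair
        (primrec_advance ha (hVT.comp Primrec.fst) (hb.comp Primrec.fst)))
  refine (Primrec.option_casesOn ho (hβ.pair hVT) h.to₂).of_eq fun y => ?_
  cases o y <;> rfl

theorem primrec_simState (hF : Primrec₂ F) (hG : Primrec₂ G) (c : ℕ) :
    Primrec (simState F G c) := by
  refine Primrec.list_foldl (f := fun σ : List Bool => σ) (g := fun _ => ([], [], []))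
    (h := fun _ y => simStep c y.1 y.2 (instruction F G y.1)) Primrec.id (Primrec.const _)
    (Primrec₂.mk ?_)
  have hx : Primrec fun y : List Bool × (List Bool × List Bool × List Bool) × Bool => y.2.1 :=
    Primrec.fst.comp Primrec.snd
  exact primrec_simStep c hx (Primrec.snd.comp Primrec.snd) ((primrec_instruction hF hG).comp hx)

end Primrec

/-- The triple `r`, if it represents a number in `[-1, 1]`. -/
def clampTriple (r : ℕ × ℕ × ℕ) : ℕ × ℕ × ℕ :=
  if r.1 ≤ r.2.1 + r.2.2 + 1 ∧ r.2.1 ≤ r.1 + r.2.2 + 1 then r else (0, 0, 0)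

theorem clamp_iff (r : ℕ × ℕ × ℕ) :
    |ratVal r| ≤ 1 ↔ r.1 ≤ r.2.1 + r.2.2 + 1 ∧ r.2.1 ≤ r.1 + r.2.2 + 1 := by
  have hpos : (0 : ℚ) < (r.2.2 : ℚ) + 1 := by positivity
  have h1 : r.1 ≤ r.2.1 + r.2.2 + 1 ↔ (r.1 : ℚ) ≤ r.2.1 + r.2.2 + 1 := by
    exact_mod_cast Iff.rfl
  have h2 : r.2.1 ≤ r.1 + r.2.2 + 1 ↔ (r.2.1 : ℚ) ≤ r.1 + r.2.2 + 1 := by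
    exact_mod_cast Iff.rfl
  rw [ratVal, abs_div, abs_of_pos hpos, div_le_one hpos, abs_sub_le_iff, h1, h2]
  constructor <;> rintro ⟨_, _⟩ <;> constructor <;> linarith

theorem abs_ratVal_clampTriple_le (r : ℕ × ℕ × ℕ) : |ratVal (clampTriple r)| ≤ 1 := by
  unfold clampTriple
  split_ifs with h
  · exact (clamp_iff r).2 h
  · simp [ratVal]

theorem clampTriple_eq {r : ℕ × ℕ × ℕ} (h : |ratVal r| ≤ 1) : clampTriple r = r :=
  if_pos ((clamp_iff r).1 h)

theorem primrec_clampTriple : Primrec clampTriple := by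
  have h1 : Primrec fun r : ℕ × ℕ × ℕ => r.1 := Primrec.fst
  have h2 : Primrec fun r : ℕ × ℕ × ℕ => r.2.1 := Primrec.fst.comp Primrec.snd
  have h3 : Primrec fun r : ℕ × ℕ × ℕ => r.2.2 := Primrec.snd.comp Primrec.snd
  exact Primrec.ite (PrimrecPred.and
    (PrimrecRel.comp Primrec.nat_le h1 (primrec_nat_add_one.comp (Primrec.nat_add.comp h2 h3)))
    (PrimrecRel.comp Primrec.nat_le h2 (primrec_nat_add_one.comp (Primrec.nat_add.comp h1 h3))))
    Primrec.id (Primrec.const _)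

/-- The product of the factors by which the stakes `R` multiply the capital in a run, if only the
bits at locations whose parity is not `c` are bet on. -/
noncomputable def sideProd (p : ℝ) (X : ℕ → Bool) (T : ℕ → List Bool) (s : ℕ → Bool) (n : ℕ → ℕ)
    (R : List Bool → ℕ × ℕ × ℕ) (c k : ℕ) : ℝ :=
  ∏ i ∈ Finset.range k,
    if s i = true ∧ n i % 2 ≠ c then stakeFactor p (ratVal (R (T i))) (X (n i)) else 1

theorem stakeFactor_zero (p : ℝ) (b : Bool) : stakeFactor p 0 b = 1 := by
  cases b <;> simp [stakeFactor]

/-! ### Correctness of the simulation along an infinite run -/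

section

variable {X : ℕ → Bool} {c : ℕ} {f : List Bool →. Bool × ℕ} {R : List Bool → ℕ × ℕ × ℕ}
  {F : List Bool → List Bool → Option (Bool × ℕ)} {G : List Bool → List Bool → Option (ℕ × ℕ × ℕ)}
  {V T : ℕ → List Bool} {s : ℕ → Bool} {n : ℕ → ℕ}

theorem instruction_eq_some (hF : IsUse (half c X) f F)
    (hG : IsUse (half c X) (fun σ => Part.some (R σ)) G) (run : IsRun f X V T s n) {m k : ℕ}
    {z : (Bool × ℕ) × ℕ × ℕ × ℕ}
    (h : instruction F G (initSeg (half c X) m, V k, T k) = some z) :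
    z = ((s k, n k), R (T k)) := by
  simp only [instruction, Option.bind_eq_some_iff, Option.map_eq_some_iff] at h
  obtain ⟨a, ha, r, hr, rfl⟩ := h
  rw [Part.mem_unique (hF.mem ha) (run.mem k), Part.mem_some_iff.1 (hG.mem hr)]

theorem eventually_instruction (hF : IsUse (half c X) f F)
    (hG : IsUse (half c X) (fun σ => Part.some (R σ)) G) (run : IsRun f X V T s n) (k : ℕ) :
    ∃ m₀, ∀ m, m₀ ≤ m → instruction F G (initSeg (half c X) m, V k, T k) ≠ none := by
  obtain ⟨a, ha⟩ := hF.eventually (run.mem k)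
  obtain ⟨b, hb⟩ := hG.eventually (Part.mem_some (R (T k)))
  refine ⟨max a b, fun m hm => ?_⟩
  simp [instruction, ha m ((le_max_left _ _).trans hm), hb m ((le_max_right _ _).trans hm)]

/-- One step of the simulation, from a state where `m` bits of the oracle are known and `k` steps
of the run have been simulated. -/
theorem exists_simStep (hF : IsUse (half c X) f F)
    (hG : IsUse (half c X) (fun σ => Part.some (R σ)) G) (run : IsRun f X V T s n) (x : ℕ × ℕ) :
    ∃ y : ℕ × ℕ, ∀ o, instruction F G (initSeg (half c X) x.1, V x.2, T x.2) = o →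
      simStep c (initSeg (half c X) x.1, V x.2, T x.2)
        (X (simLoc c (initSeg (half c X) x.1) o)) o = (initSeg (half c X) y.1, V y.2, T y.2) ∧
      ((simLoc c (initSeg (half c X) x.1) o = 2 * x.1 + c ∧ simStake c o = (0, 0, 0) ∧
          y.1 = x.1 + 1 ∧ (y.2 = x.2 ∨ y.2 = x.2 + 1 ∧ n x.2 % 2 = c)) ∨
        (simLoc c (initSeg (half c X) x.1) o = n x.2 ∧ n x.2 % 2 ≠ c ∧
          simStake c o = (if s x.2 = true then R (T x.2) else (0, 0, 0)) ∧
          y.1 = x.1 ∧ y.2 = x.2 + 1)) ∧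
      (o ≠ none → n x.2 / 2 < x.1 → y.2 = x.2 + 1) := by
  obtain ⟨m, k⟩ := x
  have hadv : advance (s k, n k) (V k, T k) (X (n k)) = (V (k + 1), T (k + 1)) := by
    rw [run.V_succ, run.T_succ, advance, Bool.cond_eq_ite]
  have hread : initSeg (half c X) m ++ [X (2 * m + c)] = initSeg (half c X) (m + 1) :=
    (initSeg_succ _ _).symm
  cases ho : instruction F G (initSeg (half c X) m, V k, T k) with
  | none =>
    refine ⟨(m + 1, k), ?_⟩
    rintro o rfl
    simp [simStep, simLoc, simStake, hread]
  | some z =>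
    obtain rfl := instruction_eq_some hF hG run ho
    by_cases hn : n k % 2 = c
    · have hY : half c X (n k / 2) = X (n k) := by
        unfold half
        congr 1
        omega
      -- The run advances only if the bit was known before this step; should the bit just read be
      -- the one asked for, it is used in the next step.
      refine ⟨(m + 1, if n k / 2 < m then k + 1 else k), ?_⟩
      rintro o rfl
      by_cases hm : n k / 2 < m
      · have hg : (initSeg (half c X) m)[n k / 2]? = some (X (n k)) := by
          rw [initSeg_getElem?, if_pos hm, hY]
        simp only [simStep, hg, Option.elim_some, hadv]
        simp [simLoc, simStake, hread, hn, hm]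
      · simp [simStep, simLoc, simStake, hread, hn, hm]
    · refine ⟨(m, k + 1), ?_⟩
      rintro o rfl
      simp [simStep, simLoc, simStake, hn, hadv]

/-- A sequence that is Hippocratic KL random with respect to `μ_p` does not allow one to win by
bets on one half of its bits, even with the other half as an oracle. -/
theorem HippocraticKLRandom.sideProd_bounded {p : ℝ} (hX : HippocraticKLRandom p X) (hc : c < 2)
    (hf : IsSelection f) (hfc : RecursiveIn {seqOracle (KLRand.half c X)} f)
    (hR : ComputableIn {seqOracle (KLRand.half c X)} R) (hR1 : ∀ σ, |ratVal (R σ)| ≤ 1)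
    (run : IsRun f X V T s n) : ∃ C, ∀ k, sideProd p X T s n R c k ≤ C := by
  obtain ⟨F, hFp, hF⟩ := exists_isUse hfc
  obtain ⟨G, hGp, hG⟩ := exists_isUse hR
  let ins : List Bool → Option ((Bool × ℕ) × ℕ × ℕ × ℕ) :=
    fun σ => instruction F G (simState F G c σ)
  let h : List Bool → ℕ := fun σ => simLoc c (simState F G c σ).1 (ins σ)
  -- Off the true run `G` may give any value, so the stake is clamped; on the run `hR1` makes the
  -- clamping void.
  let S : List Bool → ℚ := fun σ => ratVal (clampTriple (simStake c (ins σ)))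
  have hst := primrec_simState hFp hGp c
  have hins : Primrec ins := (primrec_instruction hFp hGp).comp hst
  have hh : Primrec h := primrec_simLoc c (Primrec.fst.comp hst) hins
  have hS : ComputableRatIn ∅ S := computableRatIn_empty_iff.2
    ⟨_, (primrec_clampTriple.comp ((primrec_simStake c).comp hins)).to_comp, fun _ => rfl⟩
  obtain ⟨C, hC⟩ := hX (selectAt h) S (isSelection_selectAt h)
    (fun _ => abs_ratVal_clampTriple_le _) (recursiveIn_selectAt hh) hS
  choose nxt hnxt using exists_simStep hF hG run
  let pos : ℕ → ℕ × ℕ := fun j => nxt^[j] (0, 0)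
  have hpos : ∀ j, pos (j + 1) = nxt (pos j) := fun j => Function.iterate_succ_apply' nxt j (0, 0)
  have hstate : ∀ j, simState F G c (readBits h X j) =
      (initSeg (KLRand.half c X) (pos j).1, V (pos j).2, T (pos j).2) := by
    intro j
    induction j with
    | zero => simp [pos, readBits, simState, run.V_zero, run.T_zero]
    | succ j ih =>
      have hs : simState F G c (readBits h X (j + 1)) = simStep c (simState F G c (readBits h X j))
          (X (h (readBits h X j))) (ins (readBits h X j)) := by
        rw [readBits, simState, List.foldl_append]
        rfl
      rw [hs, hpos, ← (hnxt (pos j) _ rfl).1]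
      simp only [h, ins, ih]
  have hloc : ∀ j, h (readBits h X j) = simLoc c (initSeg (KLRand.half c X) (pos j).1)
      (instruction F G (initSeg (KLRand.half c X) (pos j).1, V (pos j).2, T (pos j).2)) := by
    intro j
    simp only [h, ins, hstate]
  have hSj : ∀ j, S (readBits h X j) = ratVal (clampTriple (simStake c
      (instruction F G (initSeg (KLRand.half c X) (pos j).1, V (pos j).2, T (pos j).2)))) := by
    intro j
    simp only [S, ins, hstate]
  have hcase := fun j => (hnxt (pos j) _ rfl).2.1
  simp only [← hloc, ← hpos] at hcase
  have hmono : ∀ i j, i ≤ j → (pos i).1 ≤ (pos j).1 ∧ (pos i).2 ≤ (pos j).2 := by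
    intro i j hij
    induction j, hij using Nat.le_induction with
    | base => exact ⟨le_rfl, le_rfl⟩
    | succ j _ ih => rcases hcase j with ⟨-, -, h1, h2⟩ | ⟨-, -, -, h1, h2⟩ <;> omega
  -- Oracle reads have parity `c` and strictly increase, the other reads have the opposite parity,
  -- and among these the locations differ because `f` is a selection function.
  have hinj : ∀ i j, i < j → h (readBits h X i) ≠ h (readBits h X j) := by
    intro i j hij
    have h1 := hmono (i + 1) j hij
    rcases hcase i with ⟨hi, -, hi1, -⟩ | ⟨hi, hi', -, -, hi2⟩ <;>
      rcases hcase j with ⟨hj, -, -, -⟩ | ⟨hj, hj', -⟩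
    · omega
    · omega
    · omega
    · rw [hi, hj]
      exact (run.n_ne hf (by omega)).symm
  -- Reading the oracle changes nothing: the stake is 0, and a step of the run at a location of
  -- parity `c` contributes the factor 1 to `sideProd`.
  have hprod : ∀ j, stakeMartingale p S (readBits h X j) = sideProd p X T s n R c (pos j).2 := by
    intro j
    have hz : ratVal (clampTriple (0, 0, 0)) = 0 := by simp [clampTriple, ratVal]
    induction j with
    | zero => simp [pos, readBits, stakeMartingale_nil, sideProd]
    | succ j ih =>
      rw [readBits, stakeMartingale_append, ih, hSj]
      rcases hcase j with ⟨-, h2, -, h4⟩ | ⟨h1, h2, h3, -, h5⟩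
      · rw [h2, hz, stakeFactor_zero, mul_one]
        rcases h4 with h4 | ⟨h4, h5⟩
        · rw [h4]
        · rw [h4, sideProd, sideProd, Finset.prod_range_succ, if_neg (fun h => h.2 h5), mul_one]
      · rw [h3, h5, h1]
        unfold sideProd
        rw [Finset.prod_range_succ]
        congr 1
        cases s (pos j).2
        · simp [hz, stakeFactor_zero]
        · simp [h2, clampTriple_eq (hR1 _)]
  have hprogress : ∀ k, ∃ j, (pos j).2 = k := by
    intro k
    induction k with
    | zero => exact ⟨0, rfl⟩
    | succ k ih =>
      obtain ⟨i, hi⟩ := ih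
      obtain ⟨m₀, hm₀⟩ := eventually_instruction hF hG run k
      -- Every step either advances the run or adds a bit of the oracle. Here `d` bounds the bits
      -- still missing: once `m₀` bits are known the instruction is defined, and once n k / 2 + 1
      -- are known so is the bit it may ask for in the oracle half.
      have key : ∀ d i, (pos i).2 = k → max m₀ (n k / 2 + 1) ≤ (pos i).1 + d →
          ∃ j, (pos j).2 = k + 1 := by
        intro d
        induction d with
        | zero =>
          intro i hi hd
          refine ⟨i + 1, ?_⟩
          rw [hpos, (hnxt (pos i) _ rfl).2.2, hi]
          · rw [hi]
            exact hm₀ _ (by omega)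
          · rw [hi]
            omega
        | succ d ihd =>
          intro i hi hd
          rcases hcase i with ⟨-, -, h1, h2 | h2⟩ | ⟨-, -, -, -, h2⟩
          · exact ihd (i + 1) (by omega) (by omega)
          · exact ⟨i + 1, by omega⟩
          · exact ⟨i + 1, by omega⟩
      exact key _ i hi (Nat.le_add_left _ _)
  refine ⟨C, fun k => ?_⟩
  obtain ⟨j, rfl⟩ := hprogress k
  rw [← hprod]
  exact hC j (readBits h X j, readBits h X j)
    (by rw [play_selectAt hinj]; exact Part.mem_some _)

end

/-- If the halves of a Hippocratic KL random sequence compute `p`, then the sequence is KL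
random. -/
theorem HippocraticKLRandom.klRandom {p : ℝ} (hp0 : 0 < p) (hp1 : p < 1) {X : ℕ → Bool}
    (hX : HippocraticKLRandom p X) (hc : ∀ c < 2, ComputesReal (KLRand.half c X) p) : KLRandom p X := by
  intro f M hM hf hMc
  by_contra hunb
  have hsel := selectsInfinitely_of_not_boundedAlong hunb
  obtain ⟨V, T, s, n, run, hplay⟩ := hsel.exists_isRun
  obtain ⟨R, hR, hR1, hfactor⟩ := exists_stake hp0 hp1 hM.nonneg hMc
  -- Since each half computes `p`, it can replace `p` as the oracle for `f` and for the stakes `R`.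
  have htrans : ∀ c < 2, ∀ g ∈ ({seqOracle (bits p)} : Set (ℕ →. ℕ)),
      RecursiveIn {seqOracle (KLRand.half c X)} g := by
    intro c hc2 g hg
    obtain rfl := Set.mem_singleton_iff.1 hg
    exact ComputableIn.comp (f := fun b : Bool => if b then 1 else 0)
      (Primrec.dom_bool _).computableIn (hc c hc2)
  have hbdd : ∀ c < 2, ∃ C, ∀ k, sideProd p X T s n R c k ≤ C := fun c hc2 =>
    hX.sideProd_bounded hc2 hM.selection (hf.subst (htrans c hc2)) (hR.subst (htrans c hc2)) hR1 run
  obtain ⟨C₀, hC₀⟩ := hbdd 0 (by norm_num)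
  obtain ⟨C₁, hC₁⟩ := hbdd 1 (by norm_num)
  have hnn : ∀ c k, 0 ≤ sideProd p X T s n R c k := fun c k => Finset.prod_nonneg fun i _ => by
    split_ifs
    · exact stakeFactor_nonneg hp0 hp1 (hR1 _) _
    · exact zero_le_one
  -- Each selected bit lies on exactly one of the two sides, so the product of the two gains is the
  -- full gain of the stakes, and it dominates M + 1 up to the shading factors.
  have hgrow : ∀ k, (∏ i ∈ Finset.range (T k).length, (2 : ℝ) ^ (i + 2) / (2 ^ (i + 2) + 1)) *
      (M (T k) + 1) ≤ (M [] + 1) * (sideProd p X T s n R 0 k * sideProd p X T s n R 1 k) := by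
    intro k
    induction k with
    | zero => simp [run.T_zero, sideProd]
    | succ k ih =>
      have hsplit : sideProd p X T s n R 0 (k + 1) * sideProd p X T s n R 1 (k + 1) =
          sideProd p X T s n R 0 k * sideProd p X T s n R 1 k *
            if s k = true then stakeFactor p (ratVal (R (T k))) (X (n k)) else 1 := by
        simp only [sideProd, Finset.prod_range_succ]
        rcases Nat.mod_two_eq_zero_or_one (n k) with h | h <;> cases s k <;> simp [h] <;> ring
      rw [hsplit, run.T_succ]
      cases hs : s k with
      | false => simpa using ih
      | true =>
        simp only [if_true, List.length_append, List.length_singleton, Finset.prod_range_succ]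
        have hfair := hfactor (T k) (hM.fair X hsel k _ (hplay k)) (X (n k))
        have hF0 := stakeFactor_nonneg hp0 hp1 (hR1 (T k)) (X (n k))
        have hprod0 : 0 ≤ ∏ i ∈ Finset.range (T k).length,
            (2 : ℝ) ^ (i + 2) / (2 ^ (i + 2) + 1) := by positivity
        have h1 := mul_le_mul_of_nonneg_left hfair hprod0
        have h2 := mul_le_mul_of_nonneg_right ih hF0
        calc _ = _ := mul_assoc _ _ _
          _ ≤ _ := h1
          _ = _ := (mul_assoc _ _ _).symm
          _ ≤ _ := h2
          _ = _ := by ring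
  -- The factor 2 undoes the total shading, which is at least 1/2 by `prod_shade_ge`.
  refine hunb ⟨2 * ((M [] + 1) * (C₀ * C₁)), fun k vt hvt => ?_⟩
  obtain rfl := Part.mem_unique hvt (hplay k)
  have hM0 := hM.nonneg (T k)
  have hM1 := hM.nonneg []
  have h1 : 1 / 2 * (M (T k) + 1) ≤ (M [] + 1) * (C₀ * C₁) :=
    (mul_le_mul_of_nonneg_right (prod_shade_ge _) (by linarith)).trans ((hgrow k).trans
      (mul_le_mul_of_nonneg_left (mul_le_mul (hC₀ k) (hC₁ k) (hnn 1 k)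
        ((hnn 0 k).trans (hC₀ k))) (by linarith)))
  dsimp only
  linarith

end KLRand

/-! ### The equivalence -/

theorem mainTheorem3 (p : ℝ) (hp0 : 0 < p) (hp1 : p < 1) :
    {X : ℕ → Bool | KLRand.HippocraticKLRandom p X} = {X : ℕ → Bool | KLRand.KLRandom p X} ↔
      ∀ X : ℕ → Bool, KLRand.HippocraticKLRandom p X → KLRand.ComputesReal X p := by
  constructor
  · intro h X hX
    have hX' : X ∈ {X : ℕ → Bool | KLRand.KLRandom p X} := h ▸ hX
    exact KLRand.KLRandom.computesReal hp0 hp1 hX'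
  · intro h
    ext X
    -- The second statement is applied to the two halves of X, not to X: the oracle must not contain
    -- the bits that are bet on.
    exact ⟨fun hX => KLRand.HippocraticKLRandom.klRandom hp0 hp1 hX fun c _ => h _ (hX.half c),
      fun hX => KLRand.KLRandom.hippocraticKLRandom hp0 hp1 hX⟩
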